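/- All manifolds are smooth, finite-dimensional, Hausdorff, second countable and without boundary. A Poisson structure on a manifold $M$ is a smooth bivector field $P\in\Gamma(\wedge^2TM)$ whose bracket $\{f,g\}=P(df,dg)$ on $C^\infty(M)$ satisfies the Jacobi identity; $P^\sharp:T^*M\to TM$ is defined by $\langle\beta,P^\sharp\alpha\rangle=P(\alpha,\beta)$. Put $\operatorname{Poiss}(M,P)=\{X\in\Gamma(TM): L_XP=0\}$, $\operatorname{Ham}(M,P)=\{P^\sharp df: f\in C^\infty(M)\}$ and $H^1_P(M)=\operatorname{Poiss}(M,P)/\operatorname{Ham}(M,P)$. A manifold is orientable if it carries a volume form, that is, a nowhere vanishing smooth form of top degree. If $M$ is orientable and $\Omega$ is a volume form on $M$, the modular vector field $Z_P^\Omega$ is the vector field given by $Z_P^\Omega(f)=\operatorname{div}^\Omega(P^\sharp df)$ for all $f\in C^\infty(M)$, where $L_X\Omega=\operatorname{div}^\Omega(X)\,\Omega$; it is a Poisson vector field, and its class $\operatorname{Mod}(M,P)=[Z_P^\Omega]\in H^1_P(M)$ does not depend on $\Omega$. The Poisson manifold $(M,P)$ is called unimodular if $M$ is orientable and $\operatorname{Mod}(M,P)=0$.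 A locally trivial Poisson fiber bundle $(\pi:M\to S,P)$ with typical fiber a Poisson manifold $(F,P_F)$ consists of a smooth map $\pi:M\to S$ and a Poisson structure $P$ on $M$ that is vertical, $P\in\Gamma(\wedge^2\ker d\pi)$, such that every point of $S$ has an open neighborhood $U$ with a diffeomorphism $\pi^{-1}(U)\to U\times F$ that commutes with the projections to $U$ and carries $P|_{\pi^{-1}(U)}$ to the product $0\oplus P_F$ of the zero Poisson structure on $U$ and $P_F$. **Corollary.** Let $(\pi:M\to S,P)$ be a locally trivial Poisson fiber bundle with typical fiber $(F,P_F)$, and suppose that the total space $M$ and the base $S$ are orientable. If $(F,P_F)$ is unimodular, then $(M,P)$ is unimodular, that is, $\operatorname{Mod}(M,P)=0$. -/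

import Mathlib

open scoped Manifold ContDiff

noncomputable section

namespace PoissonGeometry

/-! Manifolds are smooth, finite-dimensional and without boundary: they are modelled on a
finite-dimensional real normed space `E` through the model `𝓘(ℝ, E)`. -/

section SingleManifold

variable (E : Type*) [NormedAddCommGroup E] [NormedSpace ℝ E]
variable (M : Type*) [TopologicalSpace M] [ChartedSpace E M]

instance instFiniteDimensionalTangentSpace [FiniteDimensional ℝ E] (x : M) :
    FiniteDimensional ℝ (TangentSpace 𝓘(ℝ, E) x) :=
  inferInstanceAs (FiniteDimensional ℝ E)

/-- The algebra `C^∞(M)` of smooth real functions. -/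
abbrev SmoothFun : Type _ := C^∞⟮𝓘(ℝ, E), M; ℝ⟯

/-- The real vector space `Γ(TM)` of smooth vector fields. -/
abbrev VectorFld [IsManifold 𝓘(ℝ, E) ∞ M] : Type _ :=
  Cₛ^∞⟮𝓘(ℝ, E); E, (TangentSpace 𝓘(ℝ, E) : M → Type _)⟯

/-- The cotangent space `T*_x M`, the linear dual of the (finite-dimensional) tangent space. -/
abbrev CotangentSpace {M : Type*} [TopologicalSpace M] [ChartedSpace E M] (x : M) : Type _ :=
  Module.Dual ℝ (TangentSpace 𝓘(ℝ, E) x)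

variable {E M}

/-- The value at `x` of the differential `df` of a real function. -/
def differential (f : M → ℝ) (x : M) : CotangentSpace E x :=
  (mfderiv 𝓘(ℝ, E) 𝓘(ℝ, ℝ) f x).toLinearMap

/-- The derivative `X f` of a function along a vector field. -/
def dirDeriv (X : Π x : M, TangentSpace 𝓘(ℝ, E) x) (f : M → ℝ) (x : M) : ℝ :=
  differential (E := E) f x (X x)

theorem dirDeriv_add (X X' : Π x : M, TangentSpace 𝓘(ℝ, E) x) (f : M → ℝ) (x : M) :
    dirDeriv (fun y => X y + X' y) f x = dirDeriv X f x + dirDeriv X' f x := by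
  simp only [dirDeriv, map_add]

theorem dirDeriv_smul (c : ℝ) (X : Π x : M, TangentSpace 𝓘(ℝ, E) x) (f : M → ℝ) (x : M) :
    dirDeriv (fun y => c • X y) f x = c * dirDeriv X f x := by
  simp only [dirDeriv, map_smul, smul_eq_mul]

theorem differential_add (f g : M → ℝ) (x : M)
    (hf : MDifferentiableAt 𝓘(ℝ, E) 𝓘(ℝ, ℝ) f x) (hg : MDifferentiableAt 𝓘(ℝ, E) 𝓘(ℝ, ℝ) g x) :
    differential (E := E) (f + g) x = differential f x + differential g x := by
  ext v
  simp only [differential]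
  rw [mfderiv_add hf hg]
  rfl

theorem differential_smul (c : ℝ) (f : M → ℝ) (x : M)
    (hf : MDifferentiableAt 𝓘(ℝ, E) 𝓘(ℝ, ℝ) f x) :
    differential (E := E) (c • f) x = c • differential f x := by
  ext v
  simp only [differential]
  rw [const_smul_mfderiv hf c]
  rfl

theorem differential_zero (x : M) : differential (E := E) (0 : M → ℝ) x = 0 := by
  have h := differential_smul (E := E) 0 (fun _ : M => (0 : ℝ)) x mdifferentiableAt_const
  rw [zero_smul, zero_smul] at h
  exact h

variable (E M)

/-- A smooth bivector field `P`, given by its values `P x` as alternating bilinear forms on the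
cotangent spaces. Smoothness is tested on differentials of smooth functions (which span every
cotangent space). -/
structure BivectorField where
  /-- the value at `x`, as a bilinear form on `T*_x M` -/
  val : ∀ x : M, CotangentSpace E x →ₗ[ℝ] CotangentSpace E x →ₗ[ℝ] ℝ
  alternating : ∀ (x : M) (α : CotangentSpace E x), val x α α = 0
  smooth : ∀ f g : SmoothFun E M,
    ContMDiff 𝓘(ℝ, E) 𝓘(ℝ, ℝ) ∞ (fun x => val x (differential f x) (differential g x))

variable {E M}

/-- The bracket `{f, g} = P(df, dg)` on `C^∞(M)`. -/
def BivectorField.bracket (P : BivectorField E M) (f g : SmoothFun E M) : SmoothFun E M :=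
  ⟨fun x => P.val x (differential f x) (differential g x), P.smooth f g⟩

/-- The morphism `P♯ : T*M → TM`, characterized by `⟨β, P♯ α⟩ = P(α, β)`. -/
def BivectorField.sharp [FiniteDimensional ℝ E] (P : BivectorField E M) (x : M)
    (α : CotangentSpace E x) : TangentSpace 𝓘(ℝ, E) x :=
  (Module.evalEquiv ℝ (TangentSpace 𝓘(ℝ, E) x)).symm (P.val x α)

theorem BivectorField.apply_sharp [FiniteDimensional ℝ E] (P : BivectorField E M) (x : M)
    (α β : CotangentSpace E x) : β (P.sharp x α) = P.val x α β := by
  simp [BivectorField.sharp]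

/-- The Hamiltonian vector field `P♯ df`. -/
def BivectorField.hamiltonian [FiniteDimensional ℝ E] (P : BivectorField E M) (f : M → ℝ)
    (x : M) : TangentSpace 𝓘(ℝ, E) x :=
  P.sharp x (differential f x)

variable (E M)

/-- A Poisson structure: a bivector field whose bracket satisfies the Jacobi identity
(equivalently, with vanishing Schouten bracket `[P, P]`). -/
structure PoissonStructure extends BivectorField E M where
  jacobi : ∀ f g h : SmoothFun E M,
    toBivectorField.bracket f (toBivectorField.bracket g h)
      + toBivectorField.bracket g (toBivectorField.bracket h f)
      + toBivectorField.bracket h (toBivectorField.bracket f g) = 0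

variable [IsManifold 𝓘(ℝ, E) ∞ M]

/-- A volume form: a smooth, nowhere vanishing differential form of top degree. Smoothness is
tested on smooth vector fields (which span every tangent space). -/
structure VolumeForm where
  /-- the value at `x`, as an alternating form on `T_x M` -/
  val : ∀ x : M, (TangentSpace 𝓘(ℝ, E) x) [⋀^Fin (Module.finrank ℝ E)]→ₗ[ℝ] ℝ
  smooth : ∀ Y : Fin (Module.finrank ℝ E) → VectorFld E M,
    ContMDiff 𝓘(ℝ, E) 𝓘(ℝ, ℝ) ∞ (fun x => val x (fun i => Y i x))
  ne_zero : ∀ x : M, val x ≠ 0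

/-- A manifold is orientable if it carries a volume form. -/
def Orientable : Prop := Nonempty (VolumeForm E M)

variable {E M}

/-- The Lie derivative of a top-degree form, evaluated on vector fields `Y`:
`(L_X Ω)(Y₁, …, Yₙ) = X (Ω(Y₁, …, Yₙ)) - ∑ᵢ Ω(Y₁, …, [X, Yᵢ], …, Yₙ)`. -/
def VolumeForm.lieDerivative (Ω : VolumeForm E M) (X : Π x : M, TangentSpace 𝓘(ℝ, E) x)
    (Y : Fin (Module.finrank ℝ E) → VectorFld E M) (x : M) : ℝ :=
  dirDeriv X (fun y => Ω.val y (fun i => Y i y)) x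
    - ∑ i, Ω.val x (Function.update (fun j => Y j x) i
        (VectorField.mlieBracket 𝓘(ℝ, E) X (fun y => Y i y) x))

/-- `u = div^Ω X`, that is, `L_X Ω = u Ω`. -/
def VolumeForm.IsDivergence (Ω : VolumeForm E M) (X : Π x : M, TangentSpace 𝓘(ℝ, E) x)
    (u : M → ℝ) : Prop :=
  ∀ (Y : Fin (Module.finrank ℝ E) → VectorFld E M) (x : M),
    Ω.lieDerivative X Y x = u x * Ω.val x (fun i => Y i x)

theorem contMDiff_dirDeriv (X : VectorFld E M) (f : SmoothFun E M) :
    ContMDiff 𝓘(ℝ, E) 𝓘(ℝ, ℝ) ∞ (dirDeriv X f) := by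
  have hT : ContMDiff (𝓘(ℝ, E).tangent) (𝓘(ℝ, ℝ).tangent) ∞
      (tangentMap 𝓘(ℝ, E) 𝓘(ℝ, ℝ) f) :=
    f.contMDiff.contMDiff_tangentMap (by simp)
  exact (contMDiff_snd_tangentBundle_modelSpace ℝ 𝓘(ℝ, ℝ)).comp (hT.comp X.contMDiff)

variable [FiniteDimensional ℝ E]

/-- The space `Poiss(M, P)` of Poisson vector fields, `L_X P = 0`, where
`(L_X P)(df, dg) = X (P(df, dg)) - P(d(X f), dg) - P(df, d(X g))`. -/
def PoissonStructure.poissonFields (P : PoissonStructure E M) : Submodule ℝ (VectorFld E M) where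
  carrier := {X | ∀ (f g : SmoothFun E M) (x : M),
    dirDeriv X (P.bracket f g) x - P.val x (differential (dirDeriv X f) x) (differential g x)
      - P.val x (differential f x) (differential (dirDeriv X g) x) = 0}
  add_mem' := by
    intro X X' hX hX' f g x
    have hd (h : SmoothFun E M) : differential (E := E) (dirDeriv (X + X') h) x
        = differential (dirDeriv X h) x + differential (dirDeriv X' h) x := by
      rw [← differential_add _ _ x
        ((contMDiff_dirDeriv X h).mdifferentiableAt (by simp))
        ((contMDiff_dirDeriv X' h).mdifferentiableAt (by simp))]
      exact congrArg (fun u => differential u x) (funext fun y => dirDeriv_add X X' h y)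
    have h1 := hX f g x
    have h2 := hX' f g x
    have h3 := dirDeriv_add X X' (P.bracket f g) x
    rw [hd, hd]
    change dirDeriv (fun y => X y + X' y) (P.bracket f g) x - _ - _ = 0
    rw [h3, map_add, map_add, LinearMap.add_apply]
    linarith
  zero_mem' := by
    intro f g x
    have hd (h : M → ℝ) : dirDeriv (0 : VectorFld E M) h = 0 :=
      funext fun y => map_zero (differential (E := E) h y)
    simp only [hd, differential_zero, map_zero, LinearMap.zero_apply, Pi.zero_apply, sub_zero]
  smul_mem' := by
    intro c X hX f g x
    have hd (h : SmoothFun E M) : differential (E := E) (dirDeriv (c • X) h) x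
        = c • differential (dirDeriv X h) x := by
      rw [← differential_smul c _ x ((contMDiff_dirDeriv X h).mdifferentiableAt (by simp))]
      exact congrArg (fun u => differential u x) (funext fun y => dirDeriv_smul c X h y)
    have h1 := hX f g x
    have h3 := dirDeriv_smul c X (P.bracket f g) x
    rw [hd, hd]
    change dirDeriv (fun y => c • X y) (P.bracket f g) x - _ - _ = 0
    rw [h3, map_smul, map_smul, LinearMap.smul_apply, smul_eq_mul, smul_eq_mul, ← mul_sub,
      ← mul_sub, h1, mul_zero]

/-- The space `Ham(M, P)` of Hamiltonian vector fields `P♯ df`, `f ∈ C^∞(M)`. -/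
def PoissonStructure.hamiltonianFields (P : PoissonStructure E M) :
    Submodule ℝ (VectorFld E M) where
  carrier := {X | ∃ f : SmoothFun E M, ∀ x, X x = P.hamiltonian f x}
  add_mem' := by
    rintro X X' ⟨f, hf⟩ ⟨g, hg⟩
    refine ⟨f + g, fun x => ?_⟩
    have h := differential_add (E := E) f g x (f.contMDiff.mdifferentiableAt (by simp))
      (g.contMDiff.mdifferentiableAt (by simp))
    rw [ContMDiffSection.coe_add, Pi.add_apply, hf, hg]
    simp only [BivectorField.hamiltonian, BivectorField.sharp, ContMDiffMap.coe_add, h, map_add]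
  zero_mem' := by
    refine ⟨0, fun x => ?_⟩
    simp only [BivectorField.hamiltonian, BivectorField.sharp, ContMDiffMap.coe_zero,
      differential_zero, map_zero, ContMDiffSection.coe_zero, Pi.zero_apply]
  smul_mem' := by
    rintro c X ⟨f, hf⟩
    refine ⟨c • f, fun x => ?_⟩
    have h := differential_smul (E := E) c f x (f.contMDiff.mdifferentiableAt (by simp))
    rw [ContMDiffSection.coe_smul, Pi.smul_apply, hf]
    simp only [BivectorField.hamiltonian, BivectorField.sharp, ContMDiffMap.coe_smul, h, map_smul]

/-- The first Poisson cohomology `H¹_P(M) = Poiss(M, P) / Ham(M, P)`. -/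
abbrev PoissonStructure.H1 (P : PoissonStructure E M) : Type _ :=
  P.poissonFields ⧸ P.hamiltonianFields.submoduleOf P.poissonFields

/-- `Z` is the modular vector field of `P` with respect to `Ω`:
`Z f = div^Ω (P♯ df)` for all `f ∈ C^∞(M)`. -/
def PoissonStructure.IsModularField (P : PoissonStructure E M) (Ω : VolumeForm E M)
    (Z : VectorFld E M) : Prop :=
  ∀ f : SmoothFun E M, Ω.IsDivergence (P.hamiltonian f) (dirDeriv Z f)

/-- `c` is the modular class `Mod(M, P)`: for every volume form `Ω` (the class does not depend on
it), `c` is the class in `H¹_P(M)` of the modular vector field with respect to `Ω`. -/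
def PoissonStructure.IsModularClass (P : PoissonStructure E M) (c : P.H1) : Prop :=
  ∀ Ω : VolumeForm E M, ∃ Z : P.poissonFields, P.IsModularField Ω Z ∧ Submodule.Quotient.mk Z = c

/-- `(M, P)` is unimodular: `M` is orientable and `Mod(M, P) = 0`. -/
def PoissonStructure.IsUnimodular (P : PoissonStructure E M) : Prop :=
  Orientable E M ∧ P.IsModularClass 0

end SingleManifold

section Bundles

variable {EM : Type*} [NormedAddCommGroup EM] [NormedSpace ℝ EM]
variable {ES : Type*} [NormedAddCommGroup ES] [NormedSpace ℝ ES]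
variable {EF : Type*} [NormedAddCommGroup EF] [NormedSpace ℝ EF]
variable {M : Type*} [TopologicalSpace M] [ChartedSpace EM M]
variable {S : Type*} [TopologicalSpace S] [ChartedSpace ES S]
variable {F : Type*} [TopologicalSpace F] [ChartedSpace EF F]

/-- A local trivialization `e : π⁻¹(U) ≅ U × F` is Poisson if it carries `P` to the product
`0 ⊕ PF` of the zero Poisson structure on `U` and `PF` on `F`, that is,
`(e_* P)(γ, δ) = PF(γ|_{T F}, δ|_{T F})` for all covectors `γ, δ` of `U × F`, where the restriction
to `T F` is the pull-back under the inclusion of the fiber `F → U × F`, `q ↦ (s, q)`. -/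
def IsPoissonTrivialization {π : M → S} (P : PoissonStructure EM M) (PF : PoissonStructure EF F)
    (e : Bundle.Trivialization F π) : Prop :=
  ∀ m ∈ e.source,
    ∀ γ δ : Module.Dual ℝ (TangentSpace (𝓘(ℝ, ES).prod 𝓘(ℝ, EF)) (e m)),
      P.val m
          (γ ∘ₗ (mfderiv 𝓘(ℝ, EM) (𝓘(ℝ, ES).prod 𝓘(ℝ, EF)) e m).toLinearMap)
          (δ ∘ₗ (mfderiv 𝓘(ℝ, EM) (𝓘(ℝ, ES).prod 𝓘(ℝ, EF)) e m).toLinearMap)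
        = PF.val (e m).2
          (γ ∘ₗ (mfderiv 𝓘(ℝ, EF) (𝓘(ℝ, ES).prod 𝓘(ℝ, EF))
            (fun q : F => ((e m).1, q)) (e m).2).toLinearMap)
          (δ ∘ₗ (mfderiv 𝓘(ℝ, EF) (𝓘(ℝ, ES).prod 𝓘(ℝ, EF))
            (fun q : F => ((e m).1, q)) (e m).2).toLinearMap)

/-- `(π : M → S, P)` is a locally trivial Poisson fiber bundle with typical fiber `(F, PF)`:
`P` is vertical (`P ∈ Γ(∧² ker dπ)`), and every point of `S` has an open neighborhood over which
there is a smooth Poisson trivialization. -/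
structure IsLocallyTrivialPoissonBundle [FiniteDimensional ℝ EM] (π : M → S)
    (P : PoissonStructure EM M) (PF : PoissonStructure EF F) : Prop where
  smooth_proj : ContMDiff 𝓘(ℝ, EM) 𝓘(ℝ, ES) ∞ π
  vertical : ∀ (m : M) (α : CotangentSpace EM m),
    mfderiv 𝓘(ℝ, EM) 𝓘(ℝ, ES) π m (P.sharp m α) = 0
  locally_trivial : ∀ s : S, ∃ e : Bundle.Trivialization F π, s ∈ e.baseSet ∧
    ContMDiffOn 𝓘(ℝ, EM) (𝓘(ℝ, ES).prod 𝓘(ℝ, EF)) ∞ e e.source ∧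
    ContMDiffOn (𝓘(ℝ, ES).prod 𝓘(ℝ, EF)) 𝓘(ℝ, EM) ∞ e.toOpenPartialHomeomorph.symm e.target ∧
    IsPoissonTrivialization (ES := ES) P PF e

end Bundles

end PoissonGeometry

end

/-! Fix a volume form `Ω` on `M`; a function `k` is wanted whose Hamiltonian vector field is the
modular field, that is, `div^Ω (P♯df) = {k, f}` for all `f`. Unimodularity of the fiber gives `h` on
`F` with `div^{ΩF} (PF♯dg) = {h, g}`.

Over a trivialization, `P♯df` is the vertical field that on each fiber is the Hamiltonian field of
the restriction of `f`. If `Ω` is `r` times the product of `ΩS` and `ΩF`, then, `ΩS` being constant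
in vertical directions, `div^Ω (P♯df) = {h, f} + P♯df (log |r|) = {h - log |r|, f}`. So `h - log
|r|` is a local potential (`lieDerivative_hamiltonian_of_mem_source`). The computation rests on the
coordinate formula for the divergence, `da(X)/a + tr DX` with `a` the density of the volume form
(`VolumeForm.lieDerivative_mul_density`), and on the equality of the two traces for a field tangent
to the fibers (`trace_fderiv_eq_of_fst_eq_zero`).

Two local potentials may differ, but their derivatives along each `P♯df` agree, since both equal
`-div^Ω (P♯df)`. They are glued with a partition of unity pulled back from `S`: its members are
constant along fibers and `P♯df` is vertical, so the glued function keeps these derivatives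
(`exists_smoothFun_of_local`). -/

noncomputable section

open scoped Topology
open Module Filter

namespace PoissonGeometry

/-! ### Determinants and traces -/

section Determinant

variable {ι : Type*} [Fintype ι] [DecidableEq ι]
variable {V : Type*} [NormedAddCommGroup V] [NormedSpace ℝ V] [FiniteDimensional ℝ V]

/-- The determinant with respect to a basis, as a continuous multilinear map. -/
def detCMM (b : Basis ι ℝ V) : ContinuousMultilinearMap ℝ (fun _ : ι => V) ℝ where
  toMultilinearMap := b.det.toMultilinearMap
  cont := by
    change Continuous fun v : ι → V => (b.toMatrix v).det
    refine Continuous.matrix_det (continuous_matrix fun i j => ?_)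
    exact (LinearMap.continuous_of_finiteDimensional (b.coord i)).comp (continuous_apply j)

theorem detCMM_apply (b : Basis ι ℝ V) (v : ι → V) : detCMM b v = b.det v := rfl

theorem hasFDerivAt_det {W : Type*} [NormedAddCommGroup W] [NormedSpace ℝ W] (b : Basis ι ℝ V)
    {g : ι → W → V} {g' : ι → W →L[ℝ] V} {z : W} (hg : ∀ i, HasFDerivAt (g i) (g' i) z) :
    ∃ L : W →L[ℝ] ℝ, HasFDerivAt (fun y => b.det fun i => g i y) L z ∧
      ∀ w, L w = ∑ i, b.det (Function.update (fun j => g j z) i (g' i w)) := by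
  refine ⟨_, HasFDerivAt.multilinear_comp (detCMM b) hg, fun w => ?_⟩
  simp [← detCMM_apply]

theorem contDiffAt_det {W : Type*} [NormedAddCommGroup W] [NormedSpace ℝ W] (b : Basis ι ℝ V)
    {g : ι → W → V} {z : W} {n : WithTop ℕ∞} (hg : ∀ i, ContDiffAt ℝ n (g i) z) :
    ContDiffAt ℝ n (fun y => b.det fun i => g i y) z :=
  (detCMM b).contDiff.contDiffAt.comp z (contDiffAt_pi.2 hg)

/-- The infinitesimal form of `det (A ∘ v) = det A * det v`. -/
theorem sum_det_update_apply (b : Basis ι ℝ V) (A : V →ₗ[ℝ] V) (v : ι → V) :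
    ∑ i, b.det (Function.update v i (A (v i))) = LinearMap.trace ℝ V A * b.det v := by
  -- The function `t ↦ det (v + t A v)` is differentiated at `0` in two ways: by multilinearity
  -- here, and as `det (1 + t A) * det v` below.
  obtain ⟨L, hL, hL'⟩ := hasFDerivAt_det b (z := (0 : ℝ))
    (g := fun i t => v i + t • A (v i)) (g' := fun i => ContinuousLinearMap.toSpanSingleton ℝ (A (v i)))
    (fun i => by
      have h := ((hasDerivAt_id (0 : ℝ)).smul_const (A (v i))).const_add (v i)
      simpa [hasDerivAt_iff_hasFDerivAt] using h)
  have h1 : L 1 = ∑ i, b.det (Function.update v i (A (v i))) := by simp [hL']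
  let M := LinearMap.toMatrix b b A
  -- The part of `det (1 + t M)` beyond its linear term, divided by `t ^ 2`; it does not affect the
  -- derivative at `0`.
  let p : Polynomial ℝ := (1 + (Polynomial.X : Polynomial ℝ) • M.map Polynomial.C).det.divX.divX
  have h2 : (fun t : ℝ => b.det fun i => v i + t • A (v i))
      = fun t => (1 + M.trace * t + p.eval t * t ^ 2) * b.det v := by
    funext t
    rw [← Matrix.det_one_add_smul]
    have h3 : 1 + t • M = LinearMap.toMatrix b b (1 + t • A) := by
      rw [map_add, map_smul, LinearMap.toMatrix_one]
    rw [h3, LinearMap.det_toMatrix, ← Basis.det_comp]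
    rfl
  have h3 : HasDerivAt (fun t : ℝ => b.det fun i => v i + t • A (v i)) (M.trace * b.det v) 0 := by
    rw [h2]
    have h4 := (((hasDerivAt_id (0 : ℝ)).const_mul M.trace).const_add 1).add
      ((p.hasDerivAt 0).mul ((hasDerivAt_id (0 : ℝ)).pow 2))
    simpa using h4.mul_const (b.det v)
  have h4 := hL.hasDerivAt.unique h3
  rw [← h1, h4, LinearMap.trace_eq_matrix_trace ℝ b]

end Determinant

/-! ### Densities of volume forms in a parametrization -/

section Parametrization

variable {E : Type*} [NormedAddCommGroup E] [NormedSpace ℝ E]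
variable {M : Type*} [TopologicalSpace M] [ChartedSpace E M]
variable {V : Type*} [NormedAddCommGroup V] [NormedSpace ℝ V]

/-- `ψ : V → M` is a smooth parametrization of a manifold near `z`. -/
structure IsParametrizationAt (ψ : V → M) (z : V) : Prop where
  contMDiffAt : ContMDiffAt 𝓘(ℝ, V) 𝓘(ℝ, E) ∞ ψ z
  isInvertible : ∀ᶠ y in 𝓝 z, (mfderiv 𝓘(ℝ, V) 𝓘(ℝ, E) ψ y).IsInvertible

variable [IsManifold 𝓘(ℝ, E) ∞ M]

/-- The coefficient of the pull-back of a volume form by `ψ` with respect to `β`. -/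
def VolumeForm.density (Ω : VolumeForm E M) (ψ : V → M) (β : Fin (finrank ℝ E) → V) (z : V) : ℝ :=
  Ω.val (ψ z) (fun i => mfderiv 𝓘(ℝ, V) 𝓘(ℝ, E) ψ z (β i))

variable {ψ : V → M} {z : V}

/-- The pull-back by `ψ` has top degree on `V`, hence is a multiple of `β.det`. -/
theorem VolumeForm.val_mfderiv (Ω : VolumeForm E M) (ψ : V → M) (β : Basis (Fin (finrank ℝ E)) ℝ V)
    (z : V) (v : Fin (finrank ℝ E) → V) :
    Ω.val (ψ z) (fun i => mfderiv 𝓘(ℝ, V) 𝓘(ℝ, E) ψ z (v i)) = Ω.density ψ β z * β.det v := by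
  let D : V [⋀^Fin (finrank ℝ E)]→ₗ[ℝ] ℝ :=
    (Ω.val (ψ z)).compLinearMap (mfderiv 𝓘(ℝ, V) 𝓘(ℝ, E) ψ z).toLinearMap
  have h := congrArg (fun D : V [⋀^Fin (finrank ℝ E)]→ₗ[ℝ] ℝ => D v) (AlternatingMap.eq_smul_basis_det β D)
  exact h

theorem VolumeForm.density_ne_zero (Ω : VolumeForm E M)
    (h : (mfderiv 𝓘(ℝ, V) 𝓘(ℝ, E) ψ z).IsInvertible) (β : Basis (Fin (finrank ℝ E)) ℝ V) :
    Ω.density ψ β z ≠ 0 := by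
  intro h0
  apply Ω.ne_zero (ψ z)
  ext v
  choose w hw using fun i => h.surjective (v i)
  have h1 := Ω.val_mfderiv ψ β z w
  rw [h0, zero_mul] at h1
  simp only [hw] at h1
  exact h1

end Parametrization

/-! ### The divergence in a parametrization -/

section LieDerivative

variable {E : Type*} [NormedAddCommGroup E] [NormedSpace ℝ E]
variable {M : Type*} [TopologicalSpace M] [ChartedSpace E M]
variable {V : Type*} [NormedAddCommGroup V] [NormedSpace ℝ V]
variable {ψ : V → M} {z : V}

/-- `Xv` is the expression of the vector field `X` in the parametrization `ψ`. -/
def IsLocalExpression (ψ : V → M) (z : V) (X : Π x : M, TangentSpace 𝓘(ℝ, E) x) (Xv : V → V) :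
    Prop :=
  ∀ᶠ y in 𝓝 z, mfderiv 𝓘(ℝ, V) 𝓘(ℝ, E) ψ y (Xv y) = X (ψ y)

theorem IsParametrizationAt.isLocalExpression_mpullback (hψ : IsParametrizationAt (E := E) ψ z)
    (X : Π x : M, TangentSpace 𝓘(ℝ, E) x) :
    IsLocalExpression ψ z X (VectorField.mpullback 𝓘(ℝ, V) 𝓘(ℝ, E) ψ X) := by
  filter_upwards [hψ.isInvertible] with y hy
  exact hy.self_apply_inverse _

theorem IsParametrizationAt.eventuallyEq_mpullback (hψ : IsParametrizationAt (E := E) ψ z)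
    {X : Π x : M, TangentSpace 𝓘(ℝ, E) x} {Xv : V → V} (hX : IsLocalExpression ψ z X Xv) :
    Xv =ᶠ[𝓝 z] VectorField.mpullback 𝓘(ℝ, V) 𝓘(ℝ, E) ψ X := by
  filter_upwards [hψ.isInvertible, hX] with y hy hXy
  rw [VectorField.mpullback_apply, ← hXy]
  exact (hy.inverse_apply_self (Xv y : TangentSpace 𝓘(ℝ, V) y)).symm

theorem differential_comp_apply {f : M → ℝ} (hf : MDifferentiableAt 𝓘(ℝ, E) 𝓘(ℝ, ℝ) f (ψ z))
    (hψ : MDifferentiableAt 𝓘(ℝ, V) 𝓘(ℝ, E) ψ z) (v : V) :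
    differential (E := E) f (ψ z) (mfderiv 𝓘(ℝ, V) 𝓘(ℝ, E) ψ z v) = fderiv ℝ (f ∘ ψ) z v := by
  rw [← mfderiv_eq_fderiv, mfderiv_comp z hf hψ]
  rfl

variable [IsManifold 𝓘(ℝ, E) ∞ M]

theorem IsParametrizationAt.contDiffAt_of_isLocalExpression [CompleteSpace V]
    (hψ : IsParametrizationAt (E := E) ψ z)
    {X : Π x : M, TangentSpace 𝓘(ℝ, E) x} {Xv : V → V} (hX : IsLocalExpression ψ z X Xv)
    (hs : ContMDiffAt 𝓘(ℝ, E) (𝓘(ℝ, E).prod 𝓘(ℝ, E)) ∞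
      (fun x => Bundle.TotalSpace.mk' E (E := (TangentSpace 𝓘(ℝ, E) : M → Type _)) x (X x)) (ψ z)) :
    ContDiffAt ℝ ∞ Xv z := by
  have : IsManifold 𝓘(ℝ, E) 1 M := IsManifold.of_le (n := ∞) (by simp)
  have h := ContMDiffAt.mpullback_vectorField_preimage (I := 𝓘(ℝ, V)) hs hψ.contMDiffAt
    hψ.isInvertible.self_of_nhds (m := ∞) (by simp)
  exact (contMDiffAt_vectorSpace_iff_contDiffAt.1 h).congr_of_eventuallyEq
    (hψ.eventuallyEq_mpullback hX)

/-- Smoothness and the Lie derivative of a volume form are tested on global vector fields only; this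
supplies enough of them to reach every frame at a point. -/
theorem exists_vectorFld_apply_eq [FiniteDimensional ℝ E] [T2Space M] [SecondCountableTopology M]
    (x : M) (v : TangentSpace 𝓘(ℝ, E) x) : ∃ Y : VectorFld E M, Y x = v := by
  classical
  have : LocallyCompactSpace M := ChartedSpace.locallyCompactSpace E M
  obtain ⟨Y, hY⟩ := exists_contMDiffSection_forall_mem_convex_of_local (n := ⊤) 𝓘(ℝ, E)
    -- The convex constraint is `{v}` in the fiber over `x` and vacuous elsewhere.
    (TangentSpace 𝓘(ℝ, E) : M → Type _) (fun y => {w | ∀ h : y = x, w = h ▸ v})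
    (fun y => by
      rcases eq_or_ne y x with rfl | hy
      · simp
      · simpa [hy] using convex_univ)
    (fun y => by
      rcases eq_or_ne y x with rfl | hy
      · obtain ⟨s, hs, hY⟩ := FiberBundle.exists_contMDiffOn_extend 𝓘(ℝ, E) E
          (V := (TangentSpace 𝓘(ℝ, E) : M → Type _)) (k := ∞) v
        refine ⟨s, hs, _, hY, ?_⟩
        rintro w - rfl
        exact FiberBundle.extend_apply_self ..
      · exact ⟨{x}ᶜ, isOpen_compl_singleton.mem_nhds hy, 0,
          (Bundle.contMDiff_zeroSection ℝ _).contMDiffOn, fun w hw h => absurd h hw⟩)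
  exact ⟨Y, hY x rfl⟩

/-- For global fields `Y` that equal the coordinate frame at the one point `ψ z`, the smooth
function `Ω(Y) ∘ ψ` is the density times the determinant of the local expressions of `Y`. That
determinant is `1` at `z`, so near `z` the density is a quotient of smooth functions. -/
theorem VolumeForm.contDiffAt_density [FiniteDimensional ℝ E] [T2Space M]
    [SecondCountableTopology M] [FiniteDimensional ℝ V] (Ω : VolumeForm E M)
    (hψ : IsParametrizationAt (E := E) ψ z) (β : Basis (Fin (finrank ℝ E)) ℝ V) :
    ContDiffAt ℝ ∞ (Ω.density ψ β) z := by
  have : CompleteSpace V := FiniteDimensional.complete ℝ V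
  choose Y hY using fun i => exists_vectorFld_apply_eq (ψ z) (mfderiv 𝓘(ℝ, V) 𝓘(ℝ, E) ψ z (β i))
  let Yv : Fin (finrank ℝ E) → V → V := fun i => VectorField.mpullback 𝓘(ℝ, V) 𝓘(ℝ, E) ψ (Y i)
  have hYv (i) : IsLocalExpression ψ z (Y i) (Yv i) := hψ.isLocalExpression_mpullback (Y i)
  have hdet : ContDiffAt ℝ ∞ (fun y => β.det fun i => Yv i y) z :=
    contDiffAt_det β fun i => hψ.contDiffAt_of_isLocalExpression (hYv i) (Y i).contMDiff.contMDiffAt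
  have hval : ContDiffAt ℝ ∞ (fun y => Ω.val (ψ y) fun i => Y i (ψ y)) z :=
    ((Ω.smooth Y).contMDiffAt.comp z hψ.contMDiffAt).contDiffAt
  have hz : β.det (fun i => Yv i z) = 1 := by
    have h (i) : Yv i z = β i := by
      change (mfderiv 𝓘(ℝ, V) 𝓘(ℝ, E) ψ z).inverse (Y i (ψ z)) = β i
      rw [hY]
      exact hψ.isInvertible.self_of_nhds.inverse_apply_self (β i : TangentSpace 𝓘(ℝ, V) z)
    simp only [h]
    exact β.det_self
  refine (hval.div hdet (by rw [hz]; exact one_ne_zero)).congr_of_eventuallyEq ?_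
  have hne := hdet.continuousAt.eventually_ne (y := 0) (by rw [hz]; exact one_ne_zero)
  filter_upwards [hne, eventually_all.2 hYv] with y hy hYy
  rw [Pi.div_apply, eq_div_iff hy, ← Ω.val_mfderiv]
  simp only [hYy]

/-- The Lie derivative of a volume form in a parametrization. -/
theorem VolumeForm.lieDerivative_mul_density [FiniteDimensional ℝ E] [T2Space M]
    [SecondCountableTopology M] [FiniteDimensional ℝ V] (Ω : VolumeForm E M)
    (hψ : IsParametrizationAt (E := E) ψ z) (β : Basis (Fin (finrank ℝ E)) ℝ V)
    {X : Π x : M, TangentSpace 𝓘(ℝ, E) x} {Xv : V → V} (hX : IsLocalExpression ψ z X Xv)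
    (hs : ContMDiffAt 𝓘(ℝ, E) (𝓘(ℝ, E).prod 𝓘(ℝ, E)) ∞
      (fun x => Bundle.TotalSpace.mk' E (E := (TangentSpace 𝓘(ℝ, E) : M → Type _)) x (X x)) (ψ z))
    (Y : Fin (finrank ℝ E) → VectorFld E M) :
    Ω.lieDerivative X Y (ψ z) * Ω.density ψ β z
      = (fderiv ℝ (Ω.density ψ β) z (Xv z)
          + LinearMap.trace ℝ V (fderiv ℝ Xv z).toLinearMap * Ω.density ψ β z)
        * Ω.val (ψ z) (fun i => Y i (ψ z)) := by
  have : CompleteSpace V := FiniteDimensional.complete ℝ V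
  have : CompleteSpace E := FiniteDimensional.complete ℝ E
  have : IsManifold 𝓘(ℝ, E) (minSmoothness ℝ 2) M :=
    IsManifold.of_le (n := ∞) (by simp; exact WithTop.coe_le_coe.2 le_top)
  let Yv : Fin (finrank ℝ E) → V → V := fun i => VectorField.mpullback 𝓘(ℝ, V) 𝓘(ℝ, E) ψ (Y i)
  have hYv (i) : IsLocalExpression ψ z (Y i) (Yv i) := hψ.isLocalExpression_mpullback (Y i)
  have hYc (i) : DifferentiableAt ℝ (Yv i) z :=
    (hψ.contDiffAt_of_isLocalExpression (hYv i) (Y i).contMDiff.contMDiffAt).differentiableAt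
      (by simp)
  have hψd : MDifferentiableAt 𝓘(ℝ, V) 𝓘(ℝ, E) ψ z := hψ.contMDiffAt.mdifferentiableAt (by simp)
  set a := Ω.density ψ β with ha
  have had : DifferentiableAt ℝ a z := (Ω.contDiffAt_density hψ β).differentiableAt (by simp)
  obtain ⟨L, hL, hL'⟩ := hasFDerivAt_det β fun i => (hYc i).hasFDerivAt
  have hΩ : (fun x => Ω.val x fun i => Y i x) ∘ ψ =ᶠ[𝓝 z] fun y => a y * β.det fun i => Yv i y := by
    filter_upwards [eventually_all.2 hYv] with y hy
    rw [ha, ← Ω.val_mfderiv]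
    simp only [hy, Function.comp]
  have hXz := hX.self_of_nhds
  have hYz (i) := (hYv i).self_of_nhds
  have h1 : dirDeriv X (fun x => Ω.val x fun i => Y i x) (ψ z)
      = a z * L (Xv z) + fderiv ℝ a z (Xv z) * β.det fun i => Yv i z := by
    rw [dirDeriv, ← hXz, differential_comp_apply ((Ω.smooth Y).mdifferentiableAt (by simp)) hψd,
      hΩ.fderiv_eq, (had.hasFDerivAt.fun_mul hL).fderiv]
    simp [mul_comm]
  have h2 (i) : VectorField.mlieBracket 𝓘(ℝ, E) X (fun y => Y i y) (ψ z)
      = mfderiv 𝓘(ℝ, V) 𝓘(ℝ, E) ψ z (fderiv ℝ (Yv i) z (Xv z) - fderiv ℝ Xv z (Yv i z)) := by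
    have h := VectorField.mpullback_mlieBracket (I := 𝓘(ℝ, V)) (hs.mdifferentiableAt (by simp))
      ((Y i).contMDiff.contMDiffAt.mdifferentiableAt (by simp)) hψ.contMDiffAt
      (by simp; exact WithTop.coe_le_coe.2 le_top)
    have hb : VectorField.mlieBracket 𝓘(ℝ, V) (VectorField.mpullback 𝓘(ℝ, V) 𝓘(ℝ, E) ψ X) (Yv i) z
        = fderiv ℝ (Yv i) z (Xv z) - fderiv ℝ Xv z (Yv i z) := by
      rw [← VectorField.mlieBracketWithin_univ, VectorField.mlieBracketWithin_eq_lieBracketWithin,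
        (hψ.eventuallyEq_mpullback hX).fderiv_eq, (hψ.eventuallyEq_mpullback hX).self_of_nhds]
      exact congrFun VectorField.lieBracketWithin_univ z
    rw [← hb]
    change _ = mfderiv 𝓘(ℝ, V) 𝓘(ℝ, E) ψ z (VectorField.mlieBracket 𝓘(ℝ, V) _
      (VectorField.mpullback 𝓘(ℝ, V) 𝓘(ℝ, E) ψ (Y i)) z)
    rw [← h]
    exact (hψ.isInvertible.self_of_nhds.self_apply_inverse _).symm
  have h3 (i) : Ω.val (ψ z) (Function.update (fun j => Y j (ψ z)) i
        (VectorField.mlieBracket 𝓘(ℝ, E) X (fun y => Y i y) (ψ z)))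
      = a z * (β.det (Function.update (fun j => Yv j z) i (fderiv ℝ (Yv i) z (Xv z)))
        - β.det (Function.update (fun j => Yv j z) i (fderiv ℝ Xv z (Yv i z)))) := by
    rw [← AlternatingMap.map_update_sub, ← Ω.val_mfderiv, h2]
    congr 1
    funext j
    rcases eq_or_ne j i with rfl | hj
    · simp only [Function.update_self]
    · simp only [Function.update_of_ne hj]
      exact (hYz j).symm
  have h4 : Ω.val (ψ z) (fun i => Y i (ψ z)) = a z * β.det fun i => Yv i z := hΩ.self_of_nhds
  have h5 := sum_det_update_apply β (fderiv ℝ Xv z).toLinearMap fun i => Yv i z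
  simp only [ContinuousLinearMap.coe_coe] at h5
  -- The terms containing `DYᵢ(X)` come once from the product rule and once from the brackets, and
  -- cancel; the terms containing `DX(Yᵢ)` add up to the trace.
  rw [VolumeForm.lieDerivative, h1, Finset.sum_congr rfl fun i _ => h3 i, ← Finset.mul_sum,
    Finset.sum_sub_distrib, ← hL', h5, h4]
  ring

end LieDerivative

/-! ### Hamiltonian vector fields and the modular class -/

section Hamiltonian

variable {E : Type*} [NormedAddCommGroup E] [NormedSpace ℝ E]
variable {M : Type*} [TopologicalSpace M] [ChartedSpace E M]

theorem BivectorField.val_swap (P : BivectorField E M) (x : M) (α β : CotangentSpace E x) :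
    P.val x α β = -P.val x β α := by
  have h := P.alternating x (α + β)
  simp only [map_add, LinearMap.add_apply, P.alternating, zero_add, add_zero] at h
  linarith

theorem differential_congr {f g : M → ℝ} {x : M} (h : f =ᶠ[𝓝 x] g) :
    differential (E := E) f x = differential g x := by
  ext v
  exact congrArg (fun L : E →L[ℝ] ℝ => L v) h.mfderiv_eq

variable [FiniteDimensional ℝ E]

theorem BivectorField.differential_hamiltonian (P : BivectorField E M) (f g : M → ℝ) (x : M) :
    differential (E := E) g x (P.hamiltonian f x)
      = P.val x (differential f x) (differential g x) :=
  P.apply_sharp x _ _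

theorem BivectorField.dirDeriv_hamiltonian (P : BivectorField E M) (f g : SmoothFun E M) :
    dirDeriv (P.hamiltonian f) g = P.bracket f g :=
  funext fun x => P.differential_hamiltonian f g x

variable [IsManifold 𝓘(ℝ, E) ∞ M]

/-- A vector field is smooth if its derivatives of smooth functions are smooth. -/
theorem contMDiff_of_dirDeriv [T2Space M] {X : Π x : M, TangentSpace 𝓘(ℝ, E) x}
    (hX : ∀ g : SmoothFun E M, ContMDiff 𝓘(ℝ, E) 𝓘(ℝ, ℝ) ∞ (dirDeriv X g)) :
    ContMDiff 𝓘(ℝ, E) (𝓘(ℝ, E).prod 𝓘(ℝ, E)) ∞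
      (fun x => Bundle.TotalSpace.mk' E (E := (TangentSpace 𝓘(ℝ, E) : M → Type _)) x (X x)) := by
  have : IsManifold 𝓘(ℝ, E) 1 M := IsManifold.of_le (n := ∞) (by simp)
  intro x₀
  rw [Bundle.contMDiffAt_section]
  let b := Module.finBasis ℝ E
  let χ : SmoothBumpFunction 𝓘(ℝ, E) x₀ := Classical.arbitrary _
  let φ := extChartAt 𝓘(ℝ, E) x₀
  let ℓ : ∀ i, E →L[ℝ] ℝ := fun i => (b.coord i).toContinuousLinearMap
  have hφ : ContMDiffOn 𝓘(ℝ, E) 𝓘(ℝ, E) ∞ φ (chartAt E x₀).source := contMDiffOn_extChartAt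
  -- Coordinate functions cut off by a bump function are globally smooth, and near `x₀` their
  -- derivatives along `X` are the components of `X` in the chart.
  let g : ∀ i, SmoothFun E M := fun i => ⟨fun x => χ x • ℓ i (φ x),
    χ.contMDiff_smul ((ℓ i).contMDiff.comp_contMDiffOn hφ)⟩
  have hg (i) : (fun x => ℓ i ((trivializationAt E (TangentSpace 𝓘(ℝ, E)) x₀ ⟨x, X x⟩).2))
      =ᶠ[𝓝 x₀] dirDeriv X (g i) := by
    filter_upwards [(eventually_eventually_nhds.2 χ.eventuallyEq_one),
      (chartAt E x₀).open_source.mem_nhds (mem_chart_source E x₀)] with x hx hxs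
    have h1 : (g i : M → ℝ) =ᶠ[𝓝 x] ℓ i ∘ φ := by
      filter_upwards [hx] with y hy
      change χ y • ℓ i (φ y) = ℓ i (φ y)
      rw [hy, Pi.one_apply, one_smul]
    have hd : MDifferentiableAt 𝓘(ℝ, E) 𝓘(ℝ, E) φ x := mdifferentiableAt_extChartAt hxs
    rw [dirDeriv, differential_congr h1]
    change _ = mfderiv 𝓘(ℝ, E) 𝓘(ℝ, ℝ) (ℓ i ∘ φ) x (X x)
    rw [mfderiv_comp x (ℓ i).mdifferentiableAt hd, ContinuousLinearMap.mfderiv_eq,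
      ← TangentBundle.continuousLinearMapAt_trivializationAt hxs]
    change _ = ℓ i (Bundle.Trivialization.continuousLinearMapAt ℝ _ x (X x))
    rw [Bundle.Trivialization.continuousLinearMapAt_apply,
      Bundle.Trivialization.coe_linearMapAt_of_mem _ (by simpa using hxs)]
  have h2 (i) : ContMDiffAt 𝓘(ℝ, E) 𝓘(ℝ, ℝ) ∞
      (fun x => ℓ i ((trivializationAt E (TangentSpace 𝓘(ℝ, E)) x₀ ⟨x, X x⟩).2)) x₀ :=
    (hX (g i)).contMDiffAt.congr_of_eventuallyEq (hg i)
  have h3 : ContMDiffAt 𝓘(ℝ, E) 𝓘(ℝ, E) ∞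
      (fun x => ∑ i, ℓ i ((trivializationAt E (TangentSpace 𝓘(ℝ, E)) x₀ ⟨x, X x⟩).2) • b i) x₀ :=
    contMDiffAt_finsetSum fun i _ => (h2 i).smul contMDiffAt_const
  convert h3 using 2 with x
  exact (b.sum_repr _).symm

variable [T2Space M] (P : PoissonStructure E M) (h : SmoothFun E M)

theorem PoissonStructure.contMDiff_hamiltonian :
    ContMDiff 𝓘(ℝ, E) (𝓘(ℝ, E).prod 𝓘(ℝ, E)) ∞
      (fun x => Bundle.TotalSpace.mk' E (E := (TangentSpace 𝓘(ℝ, E) : M → Type _)) x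
        (P.hamiltonian h x)) :=
  contMDiff_of_dirDeriv fun g => by
    rw [P.dirDeriv_hamiltonian]
    exact (P.bracket h g).contMDiff

/-- The Hamiltonian vector field of a smooth function, as a smooth section of `TM`. -/
def PoissonStructure.hamiltonianField : VectorFld E M :=
  ⟨P.hamiltonian h, P.contMDiff_hamiltonian h⟩

theorem PoissonStructure.hamiltonianField_mem_hamiltonianFields :
    P.hamiltonianField h ∈ P.hamiltonianFields :=
  ⟨h, fun _ => rfl⟩

/-- The Jacobi identity, rearranged by antisymmetry, says that `{h, ·}` is a derivation of the
bracket. -/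
theorem PoissonStructure.hamiltonianField_mem_poissonFields :
    P.hamiltonianField h ∈ P.poissonFields := by
  intro f g x
  have hd (k : SmoothFun E M) : dirDeriv (P.hamiltonianField h) k = P.bracket h k :=
    P.dirDeriv_hamiltonian h k
  rw [hd, hd, hd]
  have hJ := DFunLike.congr_fun (P.jacobi h f g) x
  have h1 : P.val x (differential (P.bracket h f) x) (differential g x)
      = - P.bracket g (P.bracket h f) x := P.val_swap x _ _
  have h2 : differential (E := E) (P.bracket g h) x = -differential (P.bracket h g) x := by
    have h3 : (P.bracket g h : M → ℝ) = (-1 : ℝ) • (P.bracket h g : M → ℝ) := by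
      funext y
      simpa using! P.val_swap y _ _
    rw [h3, differential_smul _ _ _ ((P.bracket h g).contMDiff.mdifferentiableAt (by simp))]
    exact neg_one_smul ℝ (differential (E := E) (P.bracket h g) x)
  have h4 : P.bracket f (P.bracket g h) x
      = - P.val x (differential f x) (differential (P.bracket h g) x) := by
    change P.val x (differential f x) (differential (P.bracket g h) x) = _
    rw [h2, map_neg]
  change P.bracket h (P.bracket f g) x + P.bracket f (P.bracket g h) x
    + P.bracket g (P.bracket h f) x = 0 at hJ
  rw [h1]
  linarith

/-- A Poisson structure whose modular vector fields are Hamiltonian is unimodular. -/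
theorem PoissonStructure.isUnimodular_of_exists (hM : Orientable E M)
    (H : ∀ Ω : VolumeForm E M, ∃ h : SmoothFun E M, P.IsModularField Ω (P.hamiltonianField h)) :
    P.IsUnimodular := by
  refine ⟨hM, fun Ω => ?_⟩
  obtain ⟨h, hh⟩ := H Ω
  refine ⟨⟨_, P.hamiltonianField_mem_poissonFields h⟩, hh, ?_⟩
  exact (Submodule.Quotient.mk_eq_zero _).2 (P.hamiltonianField_mem_hamiltonianFields h)

-- A vanishing class means that the modular field is some `P♯dh`, and `P♯dh (f) = P(dh, df)`.
omit [T2Space M] in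
theorem PoissonStructure.IsUnimodular.exists_potential {P : PoissonStructure E M}
    (hP : P.IsUnimodular) (Ω : VolumeForm E M) :
    ∃ h : SmoothFun E M, ∀ f : SmoothFun E M, Ω.IsDivergence (P.hamiltonian f)
      (fun x => P.val x (differential h x) (differential f x)) := by
  obtain ⟨Z, hZ, hZ0⟩ := hP.2 Ω
  obtain ⟨h, hh⟩ := (Submodule.Quotient.mk_eq_zero _).1 hZ0
  refine ⟨h, fun f => ?_⟩
  convert hZ f using 1
  funext x
  rw [← P.differential_hamiltonian, ← hh]
  rfl

end Hamiltonian

theorem map_comp_basis {ι V : Type*} [Fintype ι] [AddCommGroup V] [Module ℝ V]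
    (b : Basis ι ℝ V) (D : V [⋀^ι]→ₗ[ℝ] ℝ) (A : V →ₗ[ℝ] V) :
    D (fun i => A (b i)) = D b * LinearMap.det A := by
  classical
  have h := b.det_comp A b
  rw [b.det_self, mul_one] at h
  rw [AlternatingMap.eq_smul_basis_det b D, AlternatingMap.smul_apply, AlternatingMap.smul_apply,
    b.det_self, smul_eq_mul, smul_eq_mul, mul_one, ← h]
  rfl

/-! ### Charts and product charts as parametrizations -/

section Charts

variable {E : Type*} [NormedAddCommGroup E] [NormedSpace ℝ E]
variable {M : Type*} [TopologicalSpace M] [ChartedSpace E M] [IsManifold 𝓘(ℝ, E) ∞ M]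

theorem contMDiffAt_extChartAt_symm (x : M) {y : E} (hy : y ∈ (extChartAt 𝓘(ℝ, E) x).target) :
    ContMDiffAt 𝓘(ℝ, E) 𝓘(ℝ, E) ∞ (extChartAt 𝓘(ℝ, E) x).symm y :=
  (contMDiffOn_extChartAt_symm x).contMDiffAt ((isOpen_extChartAt_target x).mem_nhds hy)

theorem isInvertible_mfderiv_extChartAt_symm (x : M) {y : E}
    (hy : y ∈ (extChartAt 𝓘(ℝ, E) x).target) :
    (mfderiv 𝓘(ℝ, E) 𝓘(ℝ, E) (extChartAt 𝓘(ℝ, E) x).symm y).IsInvertible := by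
  have : IsManifold 𝓘(ℝ, E) 1 M := IsManifold.of_le (n := ∞) (by simp)
  have h := isInvertible_mfderivWithin_extChartAt_symm hy
  rwa [ModelWithCorners.range_eq_univ, mfderivWithin_univ] at h

theorem isParametrizationAt_extChartAt_symm (x : M) {y : E}
    (hy : y ∈ (extChartAt 𝓘(ℝ, E) x).target) :
    IsParametrizationAt (E := E) (extChartAt 𝓘(ℝ, E) x).symm y := by
  refine ⟨contMDiffAt_extChartAt_symm x hy, ?_⟩
  filter_upwards [(isOpen_extChartAt_target x).mem_nhds hy] with w hw
  exact isInvertible_mfderiv_extChartAt_symm x hw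

end Charts

section ProductChart

variable {ES : Type*} [NormedAddCommGroup ES] [NormedSpace ℝ ES]
variable {EF : Type*} [NormedAddCommGroup EF] [NormedSpace ℝ EF]
variable {S : Type*} [TopologicalSpace S] [ChartedSpace ES S] [IsManifold 𝓘(ℝ, ES) ∞ S]
variable {F : Type*} [TopologicalSpace F] [ChartedSpace EF F] [IsManifold 𝓘(ℝ, EF) ∞ F]

/-- The parametrization of `S × F` by the product of the inverses of two charts. -/
def productParam (s : S) (q : F) (z : ES × EF) : S × F :=
  ((extChartAt 𝓘(ℝ, ES) s).symm z.1, (extChartAt 𝓘(ℝ, EF) q).symm z.2)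

variable (ES EF) in
/-- The domain of the product parametrization. -/
def productTarget (s : S) (q : F) : Set (ES × EF) :=
  (extChartAt 𝓘(ℝ, ES) s).target ×ˢ (extChartAt 𝓘(ℝ, EF) q).target

omit [IsManifold 𝓘(ℝ, ES) ∞ S] [IsManifold 𝓘(ℝ, EF) ∞ F] in
theorem isOpen_productTarget (s : S) (q : F) : IsOpen (productTarget ES EF s q) :=
  (isOpen_extChartAt_target s).prod (isOpen_extChartAt_target q)

variable {s : S} {q : F} {z : ES × EF}

theorem contMDiffAt_productParam (hz : z ∈ productTarget ES EF s q) :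
    ContMDiffAt 𝓘(ℝ, ES × EF) (𝓘(ℝ, ES).prod 𝓘(ℝ, EF)) ∞ (productParam (ES := ES) (EF := EF) s q) z :=
  ContMDiffAt.prodMk
    ((contMDiffAt_extChartAt_symm s hz.1).comp z contDiff_fst.contDiffAt.contMDiffAt)
    ((contMDiffAt_extChartAt_symm q hz.2).comp z contDiff_snd.contDiffAt.contMDiffAt)

theorem mfderiv_productParam (hz : z ∈ productTarget ES EF s q) :
    mfderiv 𝓘(ℝ, ES × EF) (𝓘(ℝ, ES).prod 𝓘(ℝ, EF)) (productParam (ES := ES) (EF := EF) s q) z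
      = ContinuousLinearMap.prodMap
        (mfderiv 𝓘(ℝ, ES) 𝓘(ℝ, ES) (extChartAt 𝓘(ℝ, ES) s).symm z.1 : ES →L[ℝ] ES)
        (mfderiv 𝓘(ℝ, EF) 𝓘(ℝ, EF) (extChartAt 𝓘(ℝ, EF) q).symm z.2 : EF →L[ℝ] EF) := by
  have h1 := (contMDiffAt_extChartAt_symm s hz.1).mdifferentiableAt (by simp)
  have h2 := (contMDiffAt_extChartAt_symm q hz.2).mdifferentiableAt (by simp)
  have d1 : MDifferentiableAt 𝓘(ℝ, ES × EF) 𝓘(ℝ, ES) (Prod.fst : ES × EF → ES) z :=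
    differentiableAt_fst.mdifferentiableAt
  have d2 : MDifferentiableAt 𝓘(ℝ, ES × EF) 𝓘(ℝ, EF) (Prod.snd : ES × EF → EF) z :=
    differentiableAt_snd.mdifferentiableAt
  have h := mfderiv_prodMk (h1.comp z d1) (h2.comp z d2)
  rw [mfderiv_comp z h1 d1, mfderiv_comp z h2 d2, mfderiv_eq_fderiv, mfderiv_eq_fderiv,
    fderiv_fst, fderiv_snd] at h
  exact h

end ProductChart

/-! ### Smooth trivializations and the density ratio -/

section Trivialization

variable {EM : Type*} [NormedAddCommGroup EM] [NormedSpace ℝ EM]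
variable {ES : Type*} [NormedAddCommGroup ES] [NormedSpace ℝ ES]
variable {EF : Type*} [NormedAddCommGroup EF] [NormedSpace ℝ EF]
variable {M : Type*} [TopologicalSpace M] [ChartedSpace EM M]
variable {S : Type*} [TopologicalSpace S] [ChartedSpace ES S]
variable {F : Type*} [TopologicalSpace F] [ChartedSpace EF F]
variable {π : M → S}

variable (EM ES EF) in
/-- A local trivialization which is a diffeomorphism. -/
structure IsSmoothTrivialization (e : Bundle.Trivialization F π) : Prop where
  contMDiffOn : ContMDiffOn 𝓘(ℝ, EM) (𝓘(ℝ, ES).prod 𝓘(ℝ, EF)) ∞ e e.source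
  contMDiffOn_symm :
    ContMDiffOn (𝓘(ℝ, ES).prod 𝓘(ℝ, EF)) 𝓘(ℝ, EM) ∞ e.toOpenPartialHomeomorph.symm e.target

variable {e : Bundle.Trivialization F π}

namespace IsSmoothTrivialization

variable (he : IsSmoothTrivialization EM ES EF e)
include he

theorem contMDiffAt {m : M} (hm : m ∈ e.source) :
    ContMDiffAt 𝓘(ℝ, EM) (𝓘(ℝ, ES).prod 𝓘(ℝ, EF)) ∞ e m :=
  he.contMDiffOn.contMDiffAt (e.open_source.mem_nhds hm)

theorem contMDiffAt_symm {p : S × F} (hp : p ∈ e.target) :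
    ContMDiffAt (𝓘(ℝ, ES).prod 𝓘(ℝ, EF)) 𝓘(ℝ, EM) ∞ e.toOpenPartialHomeomorph.symm p :=
  he.contMDiffOn_symm.contMDiffAt (e.open_target.mem_nhds hp)

theorem mdifferentiableAt {m : M} (hm : m ∈ e.source) :
    MDifferentiableAt 𝓘(ℝ, EM) (𝓘(ℝ, ES).prod 𝓘(ℝ, EF)) e m :=
  (he.contMDiffAt hm).mdifferentiableAt (by simp)

theorem mdifferentiableAt_symm {p : S × F} (hp : p ∈ e.target) :
    MDifferentiableAt (𝓘(ℝ, ES).prod 𝓘(ℝ, EF)) 𝓘(ℝ, EM) e.toOpenPartialHomeomorph.symm p :=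
  (he.contMDiffAt_symm hp).mdifferentiableAt (by simp)

theorem mfderiv_symm_apply_mfderiv {m : M} (hm : m ∈ e.source) (v : TangentSpace 𝓘(ℝ, EM) m) :
    mfderiv (𝓘(ℝ, ES).prod 𝓘(ℝ, EF)) 𝓘(ℝ, EM) e.toOpenPartialHomeomorph.symm (e m)
      (mfderiv 𝓘(ℝ, EM) (𝓘(ℝ, ES).prod 𝓘(ℝ, EF)) e m v) = v := by
  have h := mfderiv_comp m (he.mdifferentiableAt_symm (e.map_source hm)) (he.mdifferentiableAt hm)
  have h' : e.toOpenPartialHomeomorph.symm ∘ e =ᶠ[𝓝 m] id := by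
    filter_upwards [e.open_source.mem_nhds hm] with y hy using e.left_inv hy
  have h1 := congrArg (fun L : EM →L[ℝ] EM => L v) (h.symm.trans (h'.mfderiv_eq.trans mfderiv_id))
  exact h1

theorem isInvertible_mfderiv_symm {p : S × F} (hp : p ∈ e.target) :
    (mfderiv (𝓘(ℝ, ES).prod 𝓘(ℝ, EF)) 𝓘(ℝ, EM)
      e.toOpenPartialHomeomorph.symm p).IsInvertible := by
  have hm : e.toOpenPartialHomeomorph.symm p ∈ e.source := e.map_target hp
  have hep : e (e.toOpenPartialHomeomorph.symm p) = p := e.right_inv hp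
  have hd := he.mdifferentiableAt hm
  have h := mfderiv_comp p hd (he.mdifferentiableAt_symm hp)
  have h' : e ∘ e.toOpenPartialHomeomorph.symm =ᶠ[𝓝 p] id := by
    filter_upwards [e.open_target.mem_nhds hp] with y hy using e.right_inv hy
  refine ContinuousLinearMap.IsInvertible.of_inverse
    (g := (mfderiv 𝓘(ℝ, EM) (𝓘(ℝ, ES).prod 𝓘(ℝ, EF)) e (e.toOpenPartialHomeomorph.symm p) :
      EM →L[ℝ] ES × EF)) ?_ ?_
  · ext v
    have h1 := he.mfderiv_symm_apply_mfderiv hm v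
    rw [hep] at h1
    exact h1
  · exact h.symm.trans (h'.mfderiv_eq.trans mfderiv_id)

end IsSmoothTrivialization

theorem finrank_eq_of_isInvertible {E V : Type*} [NormedAddCommGroup E] [NormedSpace ℝ E]
    [NormedAddCommGroup V] [NormedSpace ℝ V] {L : V →L[ℝ] E} (hL : L.IsInvertible) :
    finrank ℝ V = finrank ℝ E := by
  obtain ⟨A, -⟩ := hL
  exact A.toLinearEquiv.finrank_eq

/-- The parametrization of `M` given by a trivialization and charts of the base and the fiber. -/
def trivializationParam (e : Bundle.Trivialization F π) (s : S) (q : F) (z : ES × EF) : M :=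
  e.toOpenPartialHomeomorph.symm (productParam s q z)

/-- The domain of `trivializationParam`. -/
def IsAdmissible (e : Bundle.Trivialization F π) (s : S) (q : F) (z : ES × EF) : Prop :=
  z ∈ productTarget ES EF s q ∧ productParam s q z ∈ e.target

variable [IsManifold 𝓘(ℝ, ES) ∞ S] [IsManifold 𝓘(ℝ, EF) ∞ F]
variable {s : S} {q : F} {z : ES × EF}

theorem IsAdmissible.eventually (hz : IsAdmissible e s q z) : ∀ᶠ y in 𝓝 z, IsAdmissible e s q y :=
  Filter.Eventually.and ((isOpen_productTarget s q).mem_nhds hz.1)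
    ((contMDiffAt_productParam hz.1).continuousAt.eventually (e.open_target.mem_nhds hz.2))

variable (he : IsSmoothTrivialization EM ES EF e)
include he

theorem IsAdmissible.mfderiv_param (hz : IsAdmissible e s q z) (v : ES × EF) :
    mfderiv 𝓘(ℝ, ES × EF) 𝓘(ℝ, EM) (trivializationParam e s q) z v
      = mfderiv (𝓘(ℝ, ES).prod 𝓘(ℝ, EF)) 𝓘(ℝ, EM) e.toOpenPartialHomeomorph.symm
        (productParam s q z)
        ((mfderiv 𝓘(ℝ, ES) 𝓘(ℝ, ES) (extChartAt 𝓘(ℝ, ES) s).symm z.1 v.1 : ES),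
          (mfderiv 𝓘(ℝ, EF) 𝓘(ℝ, EF) (extChartAt 𝓘(ℝ, EF) q).symm z.2 v.2 : EF)) := by
  have h := mfderiv_comp z (he.mdifferentiableAt_symm hz.2)
    ((contMDiffAt_productParam hz.1).mdifferentiableAt (by simp))
  rw [mfderiv_productParam hz.1] at h
  exact congrArg (fun L : ES × EF →L[ℝ] EM => L v) h

theorem IsAdmissible.isParametrizationAt (hz : IsAdmissible e s q z) :
    IsParametrizationAt (E := EM) (trivializationParam e s q) z := by
  refine ⟨(he.contMDiffAt_symm hz.2).comp z (contMDiffAt_productParam hz.1), ?_⟩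
  filter_upwards [hz.eventually] with y hy
  obtain ⟨A, hA⟩ := isInvertible_mfderiv_extChartAt_symm s hy.1.1
  obtain ⟨B, hB⟩ := isInvertible_mfderiv_extChartAt_symm q hy.1.2
  obtain ⟨C, hC⟩ := he.isInvertible_mfderiv_symm hy.2
  have hC' : ∀ v : ES × EF, (C : (ES × EF) ≃L[ℝ] EM) v = mfderiv (𝓘(ℝ, ES).prod 𝓘(ℝ, EF)) 𝓘(ℝ, EM)
      e.toOpenPartialHomeomorph.symm (productParam s q y) v := fun v =>
    congrArg (fun L : ES × EF →L[ℝ] EM => L v) hC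
  refine ⟨((A : ES ≃L[ℝ] ES).prodCongr (B : EF ≃L[ℝ] EF)).trans (C : (ES × EF) ≃L[ℝ] EM), ?_⟩
  apply ContinuousLinearMap.ext
  intro v
  refine Eq.trans ?_ (hy.mfderiv_param he v).symm
  rw [← hA, ← hB]
  exact hC' _

variable [IsManifold 𝓘(ℝ, EM) ∞ M] [FiniteDimensional ℝ ES] [FiniteDimensional ℝ EF]

omit he in
variable (EF) in
/-- The derivative of the inverse of a chart, as an endomorphism of the model space. -/
def chartSymmDeriv (q : F) (y : EF) : EF →ₗ[ℝ] EF :=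
  (mfderiv 𝓘(ℝ, EF) 𝓘(ℝ, EF) (extChartAt 𝓘(ℝ, EF) q).symm y).toLinearMap

/-- The coefficient of the transport of `Ω` to `S × F` with respect to a basis of `ES × EF`. -/
def VolumeForm.trivializedDensity (Ω : VolumeForm EM M) (e : Bundle.Trivialization F π)
    (β : Fin (finrank ℝ EM) → ES × EF) (p : S × F) : ℝ :=
  Ω.val (e.toOpenPartialHomeomorph.symm p) fun i =>
    mfderiv (𝓘(ℝ, ES).prod 𝓘(ℝ, EF)) 𝓘(ℝ, EM) e.toOpenPartialHomeomorph.symm p (β i : ES × EF)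

/-- The parametrization differs from the inverse trivialization by a product of inverse charts, and
a top-degree form picks up the determinant of a block-diagonal map. -/
theorem IsAdmissible.density_eq (hz : IsAdmissible e s q z) (Ω : VolumeForm EM M)
    (β : Basis (Fin (finrank ℝ EM)) ℝ (ES × EF)) :
    Ω.density (trivializationParam e s q) β z = Ω.trivializedDensity e β (productParam s q z)
      * (LinearMap.det (chartSymmDeriv ES s z.1)
        * LinearMap.det (chartSymmDeriv EF q z.2)) := by
  rw [VolumeForm.density, ← LinearMap.det_prodMap]
  simp only [hz.mfderiv_param he]
  let D : (ES × EF) [⋀^Fin (finrank ℝ EM)]→ₗ[ℝ] ℝ :=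
    (Ω.val (trivializationParam e s q z)).compLinearMap
      (mfderiv (𝓘(ℝ, ES).prod 𝓘(ℝ, EF)) 𝓘(ℝ, EM) e.toOpenPartialHomeomorph.symm
        (productParam s q z)).toLinearMap
  exact map_comp_basis β D ((chartSymmDeriv ES s z.1).prodMap (chartSymmDeriv EF q z.2))

omit he [IsManifold 𝓘(ℝ, EM) ∞ M] [FiniteDimensional ℝ ES] [FiniteDimensional ℝ EF]
  [IsManifold 𝓘(ℝ, ES) ∞ S] in
theorem VolumeForm.density_extChartAt_symm (Ω : VolumeForm EF F)
    (b : Basis (Fin (finrank ℝ EF)) ℝ EF) (q : F) (y : EF) :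
    Ω.density (extChartAt 𝓘(ℝ, EF) q).symm b y
      = Ω.val ((extChartAt 𝓘(ℝ, EF) q).symm y) b
        * LinearMap.det (chartSymmDeriv EF q y) :=
  map_comp_basis b (Ω.val ((extChartAt 𝓘(ℝ, EF) q).symm y) : EF [⋀^Fin (finrank ℝ EF)]→ₗ[ℝ] ℝ) _

omit he in
/-- The ratio of `Ω` and the product of the volume forms of the base and of the fiber. -/
def densityRatio (e : Bundle.Trivialization F π) (Ω : VolumeForm EM M) (ΩS : VolumeForm ES S)
    (ΩF : VolumeForm EF F) (β : Fin (finrank ℝ EM) → ES × EF) (p : S × F) : ℝ :=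
  Ω.trivializedDensity e β p / (ΩS.val p.1 (finBasis ℝ ES) * ΩF.val p.2 (finBasis ℝ EF))

/-- The numerator and the denominator of `densityRatio` evaluate forms on a fixed basis of the model
space, read at each point in the preferred chart there, so neither need be continuous. Passing to
one fixed product chart multiplies both by the same two Jacobian determinants, so the ratio equals a
quotient of densities in that chart, which are smooth. -/
theorem IsAdmissible.densityRatio_eq (hz : IsAdmissible e s q z) (Ω : VolumeForm EM M)
    (ΩS : VolumeForm ES S) (ΩF : VolumeForm EF F) (β : Basis (Fin (finrank ℝ EM)) ℝ (ES × EF)) :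
    densityRatio e Ω ΩS ΩF β (productParam s q z)
      = Ω.density (trivializationParam e s q) β z
        / (ΩS.density (extChartAt 𝓘(ℝ, ES) s).symm (finBasis ℝ ES) z.1
          * ΩF.density (extChartAt 𝓘(ℝ, EF) q).symm (finBasis ℝ EF) z.2) := by
  have hS := ΩS.density_ne_zero (isInvertible_mfderiv_extChartAt_symm s hz.1.1) (finBasis ℝ ES)
  have hF := ΩF.density_ne_zero (isInvertible_mfderiv_extChartAt_symm q hz.1.2) (finBasis ℝ EF)
  rw [hz.density_eq he]
  rw [VolumeForm.density_extChartAt_symm] at hS hF ⊢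
  rw [VolumeForm.density_extChartAt_symm]
  rw [mul_mul_mul_comm, mul_div_mul_right _ _
    (mul_ne_zero (right_ne_zero_of_mul hS) (right_ne_zero_of_mul hF))]
  rfl

end Trivialization

/-- The trace of the derivative of a vector field on a product which is tangent to the second
factor. -/
theorem trace_fderiv_eq_of_fst_eq_zero {V W : Type*} [NormedAddCommGroup V] [NormedSpace ℝ V]
    [NormedAddCommGroup W] [NormedSpace ℝ W] [FiniteDimensional ℝ V] [FiniteDimensional ℝ W]
    {G : V × W → W} {z : V × W} (hG : DifferentiableAt ℝ (fun y => ((0 : V), G y)) z) :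
    LinearMap.trace ℝ (V × W) (fderiv ℝ (fun y => ((0 : V), G y)) z).toLinearMap
      = LinearMap.trace ℝ W (fderiv ℝ (fun w => G (z.1, w)) z.2).toLinearMap := by
  have hG' : DifferentiableAt ℝ G z := hG.snd
  have h1 : fderiv ℝ (fun y => ((0 : V), G y)) z
      = (ContinuousLinearMap.inr ℝ V W).comp (fderiv ℝ G z) :=
    ((ContinuousLinearMap.inr ℝ V W).hasFDerivAt.comp z hG'.hasFDerivAt).fderiv
  have h2 : fderiv ℝ (fun w => G (z.1, w)) z.2
      = (fderiv ℝ G z).comp (ContinuousLinearMap.inr ℝ V W) :=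
    (HasFDerivAt.comp z.2 (g := G) hG'.hasFDerivAt (hasFDerivAt_prodMk_right z.1 z.2)).fderiv
  rw [h1, h2]
  -- With `i` the inclusion of the second factor, `tr (i ∘ DG) = tr (DG ∘ i)`.
  exact LinearMap.trace_comp_comm' (fderiv ℝ G z).toLinearMap (LinearMap.inr ℝ V W)

/-! ### Hamiltonian vector fields in a Poisson trivialization -/

section Trivialization

variable {EM : Type*} [NormedAddCommGroup EM] [NormedSpace ℝ EM] [FiniteDimensional ℝ EM]
variable {ES : Type*} [NormedAddCommGroup ES] [NormedSpace ℝ ES] [FiniteDimensional ℝ ES]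
variable {EF : Type*} [NormedAddCommGroup EF] [NormedSpace ℝ EF] [FiniteDimensional ℝ EF]
variable {M : Type*} [TopologicalSpace M] [ChartedSpace EM M]
variable {S : Type*} [TopologicalSpace S] [ChartedSpace ES S]
variable {F : Type*} [TopologicalSpace F] [ChartedSpace EF F]
variable {π : M → S} {e : Bundle.Trivialization F π}
variable {P : PoissonStructure EM M} {PF : PoissonStructure EF F}
variable (he : IsSmoothTrivialization EM ES EF e) (hP : IsPoissonTrivialization (ES := ES) P PF e)

/-- The restriction of a function to the fiber over `s`, transported to the typical fiber. -/
def fiberRestriction (e : Bundle.Trivialization F π) (f : M → ℝ) (s : S) (q : F) : ℝ :=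
  f (e.toOpenPartialHomeomorph.symm (s, q))

include he

omit [FiniteDimensional ℝ EM] [FiniteDimensional ℝ ES] [FiniteDimensional ℝ EF] in
theorem IsSmoothTrivialization.contMDiff_fiberRestriction (f : SmoothFun EM M) {s : S}
    (hs : s ∈ e.baseSet) : ContMDiff 𝓘(ℝ, EF) 𝓘(ℝ, ℝ) ∞ (fiberRestriction e f s) := fun q =>
  f.contMDiff.contMDiffAt.comp q (ContMDiffAt.comp q
    (he.contMDiffAt_symm (p := (s, q)) (by simpa [e.mem_target] using hs))
    (contMDiffAt_const.prodMk contMDiffAt_id))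

include hP

-- Covectors separate vectors, so both sides are paired with an arbitrary `δ`. The Poisson condition
-- is applied to `δ` and `γ = d(f ∘ e⁻¹)`, which pulls back to `df` on `M` and to the differential
-- of the restricted function on the fiber.
omit [FiniteDimensional ℝ ES] in
theorem mfderiv_hamiltonian (f : SmoothFun EM M) {m : M} (hm : m ∈ e.source) :
    (mfderiv 𝓘(ℝ, EM) (𝓘(ℝ, ES).prod 𝓘(ℝ, EF)) e m (P.hamiltonian f m) : ES × EF)
      = ((0 : ES), (PF.hamiltonian (fiberRestriction e f (e m).1) (e m).2 : EF)) := by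
  have hsymm := he.mdifferentiableAt_symm (e.map_source hm)
  have hfe : MDifferentiableAt (𝓘(ℝ, ES).prod 𝓘(ℝ, EF)) 𝓘(ℝ, ℝ)
      (f ∘ e.toOpenPartialHomeomorph.symm) (e m) :=
    (f.contMDiff.mdifferentiableAt (by simp)).comp (e m) hsymm
  let ι : F → S × F := fun q => ((e m).1, q)
  have hι : MDifferentiableAt 𝓘(ℝ, EF) (𝓘(ℝ, ES).prod 𝓘(ℝ, EF)) ι (e m).2 :=
    mdifferentiableAt_const.prodMk mdifferentiableAt_id
  let γ : Module.Dual ℝ (TangentSpace (𝓘(ℝ, ES).prod 𝓘(ℝ, EF)) (e m)) :=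
    (mfderiv (𝓘(ℝ, ES).prod 𝓘(ℝ, EF)) 𝓘(ℝ, ℝ) (f ∘ e.toOpenPartialHomeomorph.symm)
      (e m)).toLinearMap
  have h1 : γ ∘ₗ (mfderiv 𝓘(ℝ, EM) (𝓘(ℝ, ES).prod 𝓘(ℝ, EF)) e m).toLinearMap
      = differential f m := by
    have h := mfderiv_comp m hfe (he.mdifferentiableAt hm)
    have h' : (f ∘ e.toOpenPartialHomeomorph.symm) ∘ e =ᶠ[𝓝 m] f := by
      filter_upwards [e.open_source.mem_nhds hm] with y hy using congrArg f (e.left_inv hy)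
    rw [← differential_congr h']
    exact (congrArg (fun L : EM →L[ℝ] ℝ => L.toLinearMap) h).symm
  have h2 : γ ∘ₗ (mfderiv 𝓘(ℝ, EF) (𝓘(ℝ, ES).prod 𝓘(ℝ, EF)) ι (e m).2).toLinearMap
      = differential (fiberRestriction e f (e m).1) (e m).2 := by
    have h := mfderiv_comp (e m).2 (g := f ∘ e.toOpenPartialHomeomorph.symm) (f := ι) hfe hι
    exact (congrArg (fun L : EF →L[ℝ] ℝ => L.toLinearMap) h).symm
  have h3 : (mfderiv 𝓘(ℝ, EF) (𝓘(ℝ, ES).prod 𝓘(ℝ, EF)) ι (e m).2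
      (PF.hamiltonian (fiberRestriction e f (e m).1) (e m).2) : ES × EF)
      = ((0 : ES), (PF.hamiltonian (fiberRestriction e f (e m).1) (e m).2 : EF)) := by
    rw [mfderiv_prod_right]
    rfl
  rw [← h3, ← sub_eq_zero]
  refine (Module.forall_dual_apply_eq_zero_iff ℝ _).1 fun δ => ?_
  have h4 := hP m hm γ δ
  rw [h1] at h4
  change P.val m (differential f m) _ = PF.val (e m).2 (γ ∘ₗ (mfderiv 𝓘(ℝ, EF)
    (𝓘(ℝ, ES).prod 𝓘(ℝ, EF)) ι (e m).2).toLinearMap) (δ ∘ₗ (mfderiv 𝓘(ℝ, EF)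
    (𝓘(ℝ, ES).prod 𝓘(ℝ, EF)) ι (e m).2).toLinearMap) at h4
  rw [h2, ← P.apply_sharp, ← PF.apply_sharp] at h4
  rw [map_sub, sub_eq_zero]
  exact h4

omit [FiniteDimensional ℝ ES] in
theorem mfderiv_symm_hamiltonian (f : SmoothFun EM M) {p : S × F} (hp : p ∈ e.target) :
    (mfderiv (𝓘(ℝ, ES).prod 𝓘(ℝ, EF)) 𝓘(ℝ, EM) e.toOpenPartialHomeomorph.symm p
        ((0 : ES), (PF.hamiltonian (fiberRestriction e f p.1) p.2 : EF)) : EM)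
      = P.hamiltonian f (e.toOpenPartialHomeomorph.symm p) := by
  obtain ⟨m, hm, rfl⟩ : ∃ m ∈ e.source, e m = p := ⟨_, e.map_target hp, e.right_inv hp⟩
  refine Eq.trans (congrArg (mfderiv (𝓘(ℝ, ES).prod 𝓘(ℝ, EF)) 𝓘(ℝ, EM)
    e.toOpenPartialHomeomorph.symm (e m) : ES × EF →L[ℝ] EM)
    (mfderiv_hamiltonian he hP f hm).symm) ?_
  refine Eq.trans (he.mfderiv_symm_apply_mfderiv hm (P.hamiltonian f m)) ?_
  exact congrArg (fun m => (P.hamiltonian f m : EM)) (e.left_inv hm).symm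

variable [IsManifold 𝓘(ℝ, ES) ∞ S] [IsManifold 𝓘(ℝ, EF) ∞ F]
variable {s : S} {q : F} {z : ES × EF}

omit [FiniteDimensional ℝ ES] in
theorem IsAdmissible.isLocalExpression_hamiltonian (hz : IsAdmissible e s q z)
    (f : SmoothFun EM M) :
    IsLocalExpression (trivializationParam e s q) z (P.hamiltonian f) fun y =>
      ((0 : ES), VectorField.mpullback 𝓘(ℝ, EF) 𝓘(ℝ, EF) (extChartAt 𝓘(ℝ, EF) q).symm
        (PF.hamiltonian (fiberRestriction e f ((extChartAt 𝓘(ℝ, ES) s).symm y.1))) y.2) := by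
  filter_upwards [hz.eventually] with y hy
  refine (hy.mfderiv_param he _).trans
    (Eq.trans ?_ (mfderiv_symm_hamiltonian he hP f hy.2))
  have h := (isInvertible_mfderiv_extChartAt_symm q hy.1.2).self_apply_inverse
    (PF.hamiltonian (fiberRestriction e f ((extChartAt 𝓘(ℝ, ES) s).symm y.1))
      ((extChartAt 𝓘(ℝ, EF) q).symm y.2))
  refine congrArg (mfderiv (𝓘(ℝ, ES).prod 𝓘(ℝ, EF)) 𝓘(ℝ, EM)
    e.toOpenPartialHomeomorph.symm (productParam s q y) : ES × EF →L[ℝ] EM) (Prod.ext ?_ h)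
  exact map_zero (mfderiv 𝓘(ℝ, ES) 𝓘(ℝ, ES) (extChartAt 𝓘(ℝ, ES) s).symm y.1)

end Trivialization

/-! ### The local potential of the modular vector field -/

section Trivialization

variable {EM : Type*} [NormedAddCommGroup EM] [NormedSpace ℝ EM] [FiniteDimensional ℝ EM]
variable {ES : Type*} [NormedAddCommGroup ES] [NormedSpace ℝ ES] [FiniteDimensional ℝ ES]
variable {EF : Type*} [NormedAddCommGroup EF] [NormedSpace ℝ EF] [FiniteDimensional ℝ EF]
variable {M : Type*} [TopologicalSpace M] [T2Space M] [SecondCountableTopology M]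
  [ChartedSpace EM M] [IsManifold 𝓘(ℝ, EM) ∞ M]
variable {S : Type*} [TopologicalSpace S] [T2Space S] [SecondCountableTopology S]
  [ChartedSpace ES S] [IsManifold 𝓘(ℝ, ES) ∞ S]
variable {F : Type*} [TopologicalSpace F] [T2Space F] [SecondCountableTopology F]
  [ChartedSpace EF F] [IsManifold 𝓘(ℝ, EF) ∞ F]
variable {π : M → S} {e : Bundle.Trivialization F π}

/-- A potential of the modular vector field over the domain of a trivialization, as a function on
`S × F`, in terms of a potential `h` of the modular vector field of the fiber. -/
def localPotential (e : Bundle.Trivialization F π) (Ω : VolumeForm EM M) (ΩS : VolumeForm ES S)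
    (ΩF : VolumeForm EF F) (β : Fin (finrank ℝ EM) → ES × EF) (h : F → ℝ) (p : S × F) : ℝ :=
  h p.2 - Real.log (densityRatio e Ω ΩS ΩF β p)

/-- The local potential in charts. -/
def chartPotential (e : Bundle.Trivialization F π) (Ω : VolumeForm EM M) (ΩS : VolumeForm ES S)
    (ΩF : VolumeForm EF F) (β : Fin (finrank ℝ EM) → ES × EF) (h : F → ℝ) (s : S) (q : F)
    (z : ES × EF) : ℝ :=
  h ((extChartAt 𝓘(ℝ, EF) q).symm z.2)
    - (Real.log (Ω.density (trivializationParam e s q) β z)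
      - (Real.log (ΩS.density (extChartAt 𝓘(ℝ, ES) s).symm (finBasis ℝ ES) z.1)
        + Real.log (ΩF.density (extChartAt 𝓘(ℝ, EF) q).symm (finBasis ℝ EF) z.2)))

variable (he : IsSmoothTrivialization EM ES EF e) {s : S} {q : F} {z : ES × EF}
  (Ω : VolumeForm EM M) (ΩS : VolumeForm ES S) (ΩF : VolumeForm EF F)
  (β : Basis (Fin (finrank ℝ EM)) ℝ (ES × EF)) (h : SmoothFun EF F)

include he

-- The logarithm of the ratio splits because no density vanishes; as `Real.log` is `log |·|`, the
-- signs of the densities do not matter.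
omit [FiniteDimensional ℝ EM] [T2Space M] [SecondCountableTopology M] [T2Space S]
  [SecondCountableTopology S] [T2Space F] [SecondCountableTopology F] in
theorem IsAdmissible.localPotential_productParam (hz : IsAdmissible e s q z) :
    localPotential e Ω ΩS ΩF β h (productParam s q z) = chartPotential e Ω ΩS ΩF β h s q z := by
  have hS := ΩS.density_ne_zero (isInvertible_mfderiv_extChartAt_symm s hz.1.1) (finBasis ℝ ES)
  have hF := ΩF.density_ne_zero (isInvertible_mfderiv_extChartAt_symm q hz.1.2) (finBasis ℝ EF)
  have hM := Ω.density_ne_zero (hz.isParametrizationAt he).isInvertible.self_of_nhds β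
  rw [localPotential, hz.densityRatio_eq he, Real.log_div hM (mul_ne_zero hS hF),
    Real.log_mul hS hF]
  rfl

theorem IsAdmissible.contDiffAt_chartPotential (hz : IsAdmissible e s q z) :
    ContDiffAt ℝ ∞ (chartPotential e Ω ΩS ΩF β h s q) z := by
  have hS := ΩS.density_ne_zero (isInvertible_mfderiv_extChartAt_symm s hz.1.1) (finBasis ℝ ES)
  have hF := ΩF.density_ne_zero (isInvertible_mfderiv_extChartAt_symm q hz.1.2) (finBasis ℝ EF)
  have hM := Ω.density_ne_zero (hz.isParametrizationAt he).isInvertible.self_of_nhds β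
  have cM := Ω.contDiffAt_density (hz.isParametrizationAt he) β
  have cS := (ΩS.contDiffAt_density (isParametrizationAt_extChartAt_symm s hz.1.1)
    (finBasis ℝ ES)).comp z contDiffAt_fst
  have cF := (ΩF.contDiffAt_density (isParametrizationAt_extChartAt_symm q hz.1.2)
    (finBasis ℝ EF)).comp z contDiffAt_snd
  have ch : ContDiffAt ℝ ∞ (h ∘ (extChartAt 𝓘(ℝ, EF) q).symm) z.2 :=
    (h.contMDiff.contMDiffAt.comp z.2 (contMDiffAt_extChartAt_symm q hz.1.2)).contDiffAt
  exact (ch.comp z contDiffAt_snd).sub ((cM.log hM).sub ((cS.log hS).add (cF.log hF)))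

/-- The density of `ΩS` depends on the base coordinate alone, so it drops out in the direction `(0,
w)`. -/
theorem IsAdmissible.fderiv_chartPotential (hz : IsAdmissible e s q z) (w : EF) :
    fderiv ℝ (chartPotential e Ω ΩS ΩF β h s q) z (0, w)
      = fderiv ℝ (h ∘ (extChartAt 𝓘(ℝ, EF) q).symm) z.2 w
        - fderiv ℝ (Ω.density (trivializationParam e s q) β) z (0, w)
          / Ω.density (trivializationParam e s q) β z
        + fderiv ℝ (ΩF.density (extChartAt 𝓘(ℝ, EF) q).symm (finBasis ℝ EF)) z.2 w
          / ΩF.density (extChartAt 𝓘(ℝ, EF) q).symm (finBasis ℝ EF) z.2 := by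
  have hS := ΩS.density_ne_zero (isInvertible_mfderiv_extChartAt_symm s hz.1.1) (finBasis ℝ ES)
  have hF := ΩF.density_ne_zero (isInvertible_mfderiv_extChartAt_symm q hz.1.2) (finBasis ℝ EF)
  have hM := Ω.density_ne_zero (hz.isParametrizationAt he).isInvertible.self_of_nhds β
  have dM := ((Ω.contDiffAt_density (hz.isParametrizationAt he) β).differentiableAt
    (by simp)).hasFDerivAt
  have dS := (((ΩS.contDiffAt_density (isParametrizationAt_extChartAt_symm s hz.1.1)
    (finBasis ℝ ES)).differentiableAt (by simp)).hasFDerivAt).comp z hasFDerivAt_fst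
  have dF := (((ΩF.contDiffAt_density (isParametrizationAt_extChartAt_symm q hz.1.2)
    (finBasis ℝ EF)).differentiableAt (by simp)).hasFDerivAt).comp z hasFDerivAt_snd
  have ch : ContDiffAt ℝ ∞ (h ∘ (extChartAt 𝓘(ℝ, EF) q).symm) z.2 :=
    (h.contMDiff.contMDiffAt.comp z.2 (contMDiffAt_extChartAt_symm q hz.1.2)).contDiffAt
  have dh := ((ch.differentiableAt (by simp)).hasFDerivAt).comp z hasFDerivAt_snd
  have hd := dh.sub ((dM.log hM).sub ((dS.log hS).add (dF.log hF)))
  have hd' := congrArg (fun L : ES × EF →L[ℝ] ℝ => L (0, w)) hd.fderiv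
  refine Eq.trans hd' ?_
  simp
  ring

theorem IsSmoothTrivialization.contMDiffAt_localPotential {p : S × F} (hp : p ∈ e.target) :
    ContMDiffAt (𝓘(ℝ, ES).prod 𝓘(ℝ, EF)) 𝓘(ℝ, ℝ) ∞ (localPotential e Ω ΩS ΩF β h) p := by
  obtain ⟨s, q⟩ := p
  -- Charts around `(s, q)` give a local inverse of the product parametrization, through which
  -- smoothness passes from `chartPotential`.
  let θ : S × F → ES × EF := fun p => (extChartAt 𝓘(ℝ, ES) s p.1, extChartAt 𝓘(ℝ, EF) q p.2)
  have hθ : ContMDiffAt (𝓘(ℝ, ES).prod 𝓘(ℝ, EF)) 𝓘(ℝ, ES × EF) ∞ θ (s, q) :=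
    ((contMDiffAt_extChartAt (x := s)).comp (s, q) contMDiffAt_fst).prodMk_space
      ((contMDiffAt_extChartAt (x := q)).comp (s, q) contMDiffAt_snd)
  have hz : IsAdmissible e s q (θ (s, q)) :=
    ⟨⟨mem_extChartAt_target s, mem_extChartAt_target q⟩, by
      have h0 : productParam s q (θ (s, q)) = (s, q) :=
        Prod.ext (extChartAt_to_inv (I := 𝓘(ℝ, ES)) s) (extChartAt_to_inv (I := 𝓘(ℝ, EF)) q)
      rwa [h0]⟩
  refine ((hz.contDiffAt_chartPotential he Ω ΩS ΩF β h).contMDiffAt.comp (s, q)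
    hθ).congr_of_eventuallyEq ?_
  filter_upwards [hθ.continuousAt.eventually hz.eventually,
    continuousAt_fst.eventually (extChartAt_source_mem_nhds (I := 𝓘(ℝ, ES)) s),
    continuousAt_snd.eventually (extChartAt_source_mem_nhds (I := 𝓘(ℝ, EF)) q)]
    with p hp h1 h2
  have hpp : productParam s q (θ p) = p :=
    Prod.ext ((extChartAt 𝓘(ℝ, ES) s).left_inv h1) ((extChartAt 𝓘(ℝ, EF) q).left_inv h2)
  rw [Function.comp, ← hp.localPotential_productParam he, hpp]

variable {P : PoissonStructure EM M} {PF : PoissonStructure EF F}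
  (hP : IsPoissonTrivialization (ES := ES) P PF e)
  (hh : ∀ f : SmoothFun EF F, ΩF.IsDivergence (PF.hamiltonian f)
      (fun x => PF.val x (differential h x) (differential f x)))
include hP hh

/-- The coordinate divergence formula is applied on `M` to `(0, G)` and on `F` to its restriction
`x` to the fiber. The traces agree, so eliminating them expresses the divergence on `M` by `{h, fs}`
and the logarithmic derivatives of the two densities, which is the bracket with the local potential.
-/
theorem IsAdmissible.lieDerivative_hamiltonian (hz : IsAdmissible e s q z) (f : SmoothFun EM M)
    (Y : Fin (finrank ℝ EM) → VectorFld EM M) :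
    Ω.lieDerivative (P.hamiltonian f) Y (trivializationParam e s q z)
      = P.val (trivializationParam e s q z) (differential (localPotential e Ω ΩS ΩF β h ∘ e) _)
          (differential f _) * Ω.val (trivializationParam e s q z) (fun i => Y i _) := by
  have hs : ((extChartAt 𝓘(ℝ, ES) s).symm z.1) ∈ e.baseSet := e.mem_target.1 hz.2
  let fs : SmoothFun EF F := ⟨fiberRestriction e f ((extChartAt 𝓘(ℝ, ES) s).symm z.1),
    he.contMDiff_fiberRestriction f hs⟩
  let G : ES × EF → EF := fun y =>
    VectorField.mpullback 𝓘(ℝ, EF) 𝓘(ℝ, EF) (extChartAt 𝓘(ℝ, EF) q).symm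
      (PF.hamiltonian (fiberRestriction e f ((extChartAt 𝓘(ℝ, ES) s).symm y.1))) y.2
  let x : EF → EF := fun w => G (z.1, w)
  have hψ := hz.isParametrizationAt he
  have hτ := isParametrizationAt_extChartAt_symm q hz.1.2
  have hX : IsLocalExpression (trivializationParam e s q) z (P.hamiltonian f)
      fun y => ((0 : ES), G y) := hz.isLocalExpression_hamiltonian he hP f
  have hx : IsLocalExpression (extChartAt 𝓘(ℝ, EF) q).symm z.2 (PF.hamiltonian fs) x :=
    hτ.isLocalExpression_mpullback _
  have hG : DifferentiableAt ℝ (fun y => ((0 : ES), G y)) z :=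
    (hψ.contDiffAt_of_isLocalExpression hX (P.contMDiff_hamiltonian f).contMDiffAt).differentiableAt
      (by simp)
  have hM := Ω.density_ne_zero hψ.isInvertible.self_of_nhds β
  have hF := ΩF.density_ne_zero (isInvertible_mfderiv_extChartAt_symm q hz.1.2) (finBasis ℝ EF)
  have hLM := Ω.lieDerivative_mul_density hψ β hX (P.contMDiff_hamiltonian f).contMDiffAt Y
  -- Global fields with the values of the coordinate frame at this point: `ΩF` is nonzero on them,
  -- so it can be cancelled from the divergence identity on `F`.
  choose YF hYF using fun i => exists_vectorFld_apply_eq (E := EF)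
    ((extChartAt 𝓘(ℝ, EF) q).symm z.2)
    (mfderiv 𝓘(ℝ, EF) 𝓘(ℝ, EF) (extChartAt 𝓘(ℝ, EF) q).symm z.2 (finBasis ℝ EF i))
  have hΩF : ΩF.val ((extChartAt 𝓘(ℝ, EF) q).symm z.2) (fun i => YF i _) ≠ 0 := by
    simp only [hYF]
    exact hF
  have hLF := ΩF.lieDerivative_mul_density hτ (finBasis ℝ EF) hx
    (PF.contMDiff_hamiltonian fs).contMDiffAt YF
  rw [hh fs YF, mul_right_comm] at hLF
  replace hLF := mul_right_cancel₀ hΩF hLF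
  rw [trace_fderiv_eq_of_fst_eq_zero hG] at hLM
  have hdh : fderiv ℝ (h ∘ (extChartAt 𝓘(ℝ, EF) q).symm) z.2 (x z.2)
      = -PF.val ((extChartAt 𝓘(ℝ, EF) q).symm z.2) (differential h _) (differential fs _) := by
    rw [← differential_comp_apply (h.contMDiff.mdifferentiableAt (by simp))
      (hτ.contMDiffAt.mdifferentiableAt (by simp)), hx.self_of_nhds,
      PF.differential_hamiltonian, PF.val_swap]
  have heψ : e (trivializationParam e s q z) = productParam s q z := e.right_inv hz.2
  have hsource : trivializationParam e s q z ∈ e.source := e.map_target hz.2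
  have hpot : MDifferentiableAt 𝓘(ℝ, EM) 𝓘(ℝ, ℝ) (localPotential e Ω ΩS ΩF β h ∘ e)
      (trivializationParam e s q z) :=
    ((he.contMDiffAt_localPotential Ω ΩS ΩF β h (e.map_source hsource)).comp _
      (he.contMDiffAt hsource)).mdifferentiableAt (by simp)
  have hcomp : (localPotential e Ω ΩS ΩF β h ∘ e) ∘ trivializationParam e s q =ᶠ[𝓝 z]
      chartPotential e Ω ΩS ΩF β h s q := by
    filter_upwards [hz.eventually] with y hy
    rw [← hy.localPotential_productParam he]
    exact congrArg _ (e.right_inv hy.2)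
  have hdpot : P.val (trivializationParam e s q z)
      (differential (localPotential e Ω ΩS ΩF β h ∘ e) _) (differential f _)
      = - fderiv ℝ (chartPotential e Ω ΩS ΩF β h s q) z (0, x z.2) := by
    rw [P.val_swap, ← P.differential_hamiltonian, ← hX.self_of_nhds,
      differential_comp_apply hpot (hψ.contMDiffAt.mdifferentiableAt (by simp)), hcomp.fderiv_eq]
  rw [hdpot, hz.fderiv_chartPotential he, hdh]
  apply mul_right_cancel₀ hM
  rw [hLM]
  change (_ + LinearMap.trace ℝ EF (fderiv ℝ x z.2).toLinearMap * _) * _ = _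
  change _ = fderiv ℝ _ z.2 (x z.2) + _ at hLF
  have hx0 : G z = x z.2 := rfl
  rw [hx0]
  field_simp
  linear_combination (-Ω.density (trivializationParam e s q) β z
    * Ω.val (trivializationParam e s q z) (fun i => Y i _)) * hLF

/-- Over the domain of a trivialization, the modular vector field is Hamiltonian. -/
theorem lieDerivative_hamiltonian_of_mem_source {m : M} (hm : m ∈ e.source) (f : SmoothFun EM M)
    (Y : Fin (finrank ℝ EM) → VectorFld EM M) :
    Ω.lieDerivative (P.hamiltonian f) Y m
      = P.val m (differential (localPotential e Ω ΩS ΩF β h ∘ e) m) (differential f m)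
        * Ω.val m (fun i => Y i m) := by
  have hp : productParam (e m).1 (e m).2 (extChartAt 𝓘(ℝ, ES) (e m).1 (e m).1,
      extChartAt 𝓘(ℝ, EF) (e m).2 (e m).2) = e m :=
    Prod.ext (extChartAt_to_inv _) (extChartAt_to_inv _)
  have hz : IsAdmissible (ES := ES) (EF := EF) e (e m).1 (e m).2
      (extChartAt 𝓘(ℝ, ES) (e m).1 (e m).1, extChartAt 𝓘(ℝ, EF) (e m).2 (e m).2) :=
    ⟨⟨mem_extChartAt_target _, mem_extChartAt_target _⟩, by rw [hp]; exact e.map_source hm⟩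
  have hm' : trivializationParam e (e m).1 (e m).2 (extChartAt 𝓘(ℝ, ES) (e m).1 (e m).1,
      extChartAt 𝓘(ℝ, EF) (e m).2 (e m).2) = m := by
    rw [trivializationParam, hp]
    exact e.left_inv hm
  have key := hz.lieDerivative_hamiltonian he Ω ΩS ΩF β h hP hh f Y
  rwa [hm'] at key

end Trivialization

/-! ### Gluing along a partition of unity on the base -/

section Gluing

variable {E : Type*} [NormedAddCommGroup E] [NormedSpace ℝ E]
variable {M : Type*} [TopologicalSpace M] [ChartedSpace E M]

theorem differential_mul_apply {f g : M → ℝ} {x : M}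
    (hf : MDifferentiableAt 𝓘(ℝ, E) 𝓘(ℝ, ℝ) f x) (hg : MDifferentiableAt 𝓘(ℝ, E) 𝓘(ℝ, ℝ) g x)
    (v : TangentSpace 𝓘(ℝ, E) x) :
    differential (E := E) (f * g) x v
      = f x * differential g x v + g x * differential f x v :=
  congrArg (fun L : E →L[ℝ] ℝ => L v) (hf.hasMFDerivAt.mul hg.hasMFDerivAt).mfderiv

theorem differential_sum_apply {ι : Type*} (T : Finset ι) {f : ι → M → ℝ} {x : M}
    (hf : ∀ i ∈ T, MDifferentiableAt 𝓘(ℝ, E) 𝓘(ℝ, ℝ) (f i) x) :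
    MDifferentiableAt 𝓘(ℝ, E) 𝓘(ℝ, ℝ) (∑ i ∈ T, f i) x ∧ ∀ v : TangentSpace 𝓘(ℝ, E) x,
      differential (E := E) (∑ i ∈ T, f i) x v = ∑ i ∈ T, differential (f i) x v := by
  classical
  induction T using Finset.induction_on with
  | empty =>
    refine ⟨mdifferentiableAt_const, fun v => ?_⟩
    simp [differential_zero]
  | insert i T hi ih =>
    have hi' := hf i (Finset.mem_insert_self i T)
    obtain ⟨hd, hT⟩ := ih fun j hj => hf j (Finset.mem_insert_of_mem hj)
    rw [Finset.sum_insert hi]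
    refine ⟨hi'.add hd, fun v => ?_⟩
    rw [differential_add _ _ x hi' hd, Finset.sum_insert hi, LinearMap.add_apply, hT]

variable {ES : Type*} [NormedAddCommGroup ES] [NormedSpace ℝ ES] [FiniteDimensional ℝ ES]
variable {S : Type*} [TopologicalSpace S] [T2Space S] [SecondCountableTopology S]
  [ChartedSpace ES S] [IsManifold 𝓘(ℝ, ES) ∞ S]

/-- Functions defined over the preimages of an open cover of `S` can be glued, keeping their
common derivatives in the vertical directions. -/
theorem exists_smoothFun_of_local {π : M → S} (hπ : ContMDiff 𝓘(ℝ, E) 𝓘(ℝ, ES) ∞ π)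
    {U : S → Set S} (hU : ∀ s, IsOpen (U s)) (hmem : ∀ s, s ∈ U s) {k : S → M → ℝ}
    (hk : ∀ s m, π m ∈ U s → ContMDiffAt 𝓘(ℝ, E) 𝓘(ℝ, ℝ) ∞ (k s) m) :
    ∃ h : SmoothFun E M, ∀ (m : M) (v : TangentSpace 𝓘(ℝ, E) m) (c : ℝ),
      mfderiv 𝓘(ℝ, E) 𝓘(ℝ, ES) π m v = 0 →
      (∀ s, π m ∈ U s → differential (k s) m v = c) → differential h m v = c := by
  have : LocallyCompactSpace S := ChartedSpace.locallyCompactSpace ES S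
  obtain ⟨ρ, hρ⟩ := SmoothPartitionOfUnity.exists_isSubordinate 𝓘(ℝ, ES) (s := Set.univ)
    isClosed_univ U hU fun s _ => Set.mem_iUnion.2 ⟨s, hmem s⟩
  have hρπ (s) : ContMDiff 𝓘(ℝ, E) 𝓘(ℝ, ℝ) ∞ (ρ s ∘ π) := (ρ s).contMDiff.comp hπ
  have hterm (s) : ContMDiff 𝓘(ℝ, E) 𝓘(ℝ, ℝ) ∞ ((ρ s ∘ π) * k s) := by
    intro m
    -- `k s` is controlled only over `U s`; away from the closed support of `ρ s` the product
    -- vanishes locally.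
    by_cases hm : π m ∈ tsupport (ρ s)
    · exact (hρπ s).contMDiffAt.mul (hk s m (hρ s hm))
    · refine (contMDiffAt_const (c := (0 : ℝ))).congr_of_eventuallyEq ?_
      filter_upwards [hπ.continuous.continuousAt.eventually
        ((isClosed_tsupport (ρ s)).isOpen_compl.mem_nhds hm)] with y hy
      simp [image_eq_zero_of_notMem_tsupport hy]
  have hfin : LocallyFinite fun s => Function.support ((ρ s ∘ π) * k s) :=
    (ρ.locallyFinite.preimage_continuous hπ.continuous).subset fun s m hm =>
      left_ne_zero_of_mul hm
  refine ⟨⟨fun m => ∑ᶠ s, ((ρ s ∘ π) * k s) m, contMDiff_finsum hterm hfin⟩, ?_⟩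
  intro m v c hv hc
  -- Indexing by closed supports gives one finite set valid on a whole neighbourhood of `m`, as
  -- differentiation requires.
  have hev : (fun m => ∑ᶠ s, ((ρ s ∘ π) * k s) m)
      =ᶠ[𝓝 m] ∑ s ∈ ρ.fintsupport (π m), (ρ s ∘ π) * k s := by
    filter_upwards [hπ.continuous.continuousAt.eventually
      (ρ.eventually_fintsupport_subset (π m))] with y hy
    rw [finsum_eq_sum_of_support_subset, Finset.sum_apply]
    intro s hs
    exact hy (ρ.finsupport_subset_fintsupport _ ((ρ.mem_finsupport _).2 (left_ne_zero_of_mul hs)))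
  change differential (fun m => ∑ᶠ s, ((ρ s ∘ π) * k s) m) m v = c
  have hd0 (s) : differential (E := E) (ρ s ∘ π) m v = 0 := by
    have h := mfderiv_comp m ((ρ s).contMDiff.mdifferentiableAt (x := π m) (by simp))
      (hπ.mdifferentiableAt (x := m) (by simp))
    refine (congrArg (fun L : E →L[ℝ] ℝ => L v) h).trans ?_
    refine (congrArg (mfderiv 𝓘(ℝ, ES) 𝓘(ℝ, ℝ) (ρ s) (π m)) hv).trans (map_zero _)
  rw [differential_congr hev, (differential_sum_apply _ fun s _ =>
    (hterm s).mdifferentiableAt (by simp)).2]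
  have hsum (s) (hs : s ∈ ρ.fintsupport (π m)) :
      differential (E := E) ((ρ s ∘ π) * k s) m v = ρ s (π m) * c := by
    have hs' := hρ s ((ρ.mem_fintsupport_iff _ s).1 hs)
    rw [differential_mul_apply ((hρπ s).mdifferentiableAt (by simp))
      ((hk s m hs').mdifferentiableAt (by simp)), hd0, hc s hs']
    simp
  -- The Leibniz terms with `d(ρ s ∘ π)` are gone because `v` is vertical; the remaining weights sum
  -- to `1`.
  rw [Finset.sum_congr rfl hsum, ← Finset.sum_mul, ρ.sum_finsupport' _ (Set.mem_univ _)
    (ρ.finsupport_subset_fintsupport _), one_mul]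

end Gluing

end PoissonGeometry

end

/-! ### Globalization of the local potentials -/

theorem corollary3p2
    {EM : Type*} [NormedAddCommGroup EM] [NormedSpace ℝ EM] [FiniteDimensional ℝ EM]
    {ES : Type*} [NormedAddCommGroup ES] [NormedSpace ℝ ES] [FiniteDimensional ℝ ES]
    {EF : Type*} [NormedAddCommGroup EF] [NormedSpace ℝ EF] [FiniteDimensional ℝ EF]
    {M : Type*} [TopologicalSpace M] [T2Space M] [SecondCountableTopology M]
    [ChartedSpace EM M] [IsManifold 𝓘(ℝ, EM) ∞ M]
    {S : Type*} [TopologicalSpace S] [T2Space S] [SecondCountableTopology S]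
    [ChartedSpace ES S] [IsManifold 𝓘(ℝ, ES) ∞ S]
    {F : Type*} [TopologicalSpace F] [T2Space F] [SecondCountableTopology F]
    [ChartedSpace EF F] [IsManifold 𝓘(ℝ, EF) ∞ F]
    (π : M → S)
    (P : PoissonGeometry.PoissonStructure EM M) (PF : PoissonGeometry.PoissonStructure EF F)
    (hbundle : PoissonGeometry.IsLocallyTrivialPoissonBundle (ES := ES) π P PF)
    (hM : PoissonGeometry.Orientable EM M) (hS : PoissonGeometry.Orientable ES S)
    (hF : PF.IsUnimodular) :
    P.IsUnimodular := by
  open PoissonGeometry in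
  refine P.isUnimodular_of_exists hM fun Ω => ?_
  -- A point of `M` is needed for the dimension count `hdim`; on the empty manifold any potential
  -- works.
  rcases isEmpty_or_nonempty M with hempty | ⟨⟨m₀⟩⟩
  · exact ⟨0, fun f Y x => (hempty.false x).elim⟩
  obtain ⟨ΩS⟩ := hS
  obtain ⟨ΩF⟩ := hF.1
  obtain ⟨h, hh⟩ := hF.exists_potential ΩF
  choose e hmem hsmooth hsymm hPoisson using hbundle.locally_trivial
  have he (s) : IsSmoothTrivialization EM ES EF (e s) := ⟨hsmooth s, hsymm s⟩
  have hdim : Module.finrank ℝ (ES × EF) = Module.finrank ℝ EM :=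
    finrank_eq_of_isInvertible ((he (π m₀)).isInvertible_mfderiv_symm
      ((e (π m₀)).map_source ((e (π m₀)).mem_source.2 (hmem (π m₀)))))
  -- The arity of `Ω` is `finrank ℝ EM`, so a basis of `ES × EF` has to be reindexed accordingly.
  let β : Module.Basis (Fin (Module.finrank ℝ EM)) ℝ (ES × EF) :=
    (Module.finBasis ℝ (ES × EF)).reindex (finCongr hdim)
  obtain ⟨k, hk⟩ := exists_smoothFun_of_local hbundle.smooth_proj (fun s => (e s).open_baseSet) hmem
    (k := fun s => localPotential (e s) Ω ΩS ΩF β h ∘ e s) fun s m hm =>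
      ((he s).contMDiffAt_localPotential Ω ΩS ΩF β h
        ((e s).map_source ((e s).mem_source.2 hm))).comp m
        ((he s).contMDiffAt ((e s).mem_source.2 hm))
  refine ⟨k, fun f Y m => ?_⟩
  have hloc (s) (hs : π m ∈ (e s).baseSet) (Y) := lieDerivative_hamiltonian_of_mem_source (he s) Ω
    ΩS ΩF β h (hPoisson s) hh ((e s).mem_source.2 hs) f Y
  choose Y₀ hY₀ using fun i => exists_vectorFld_apply_eq (E := EM) m (Module.finBasis ℝ EM i)
  have hΩ : Ω.val m (fun i => Y₀ i m) ≠ 0 := by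
    simp only [hY₀]
    exact (AlternatingMap.map_basis_ne_zero_iff (Module.finBasis ℝ EM) (Ω.val m)).2 (Ω.ne_zero m)
  -- The right side does not involve `s`: this is the common derivative that the gluing requires.
  -- The frame `Y₀` serves only to divide by `Ω(Y₀)`.
  have hval (s) (hs : π m ∈ (e s).baseSet) :
      differential (E := EM) (localPotential (e s) Ω ΩS ΩF β h ∘ e s) m (P.hamiltonian f m)
        = -(Ω.lieDerivative (P.hamiltonian f) Y₀ m / Ω.val m (fun i => Y₀ i m)) := by
    rw [hloc s hs Y₀, mul_div_cancel_right₀ _ hΩ, P.differential_hamiltonian, P.val_swap]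
  have hkm := hk m (P.hamiltonian f m) _ (hbundle.vertical m _) hval
  have hdir : dirDeriv (P.hamiltonianField k) f m = -differential (E := EM) k m (P.hamiltonian f m) := by
    rw [P.differential_hamiltonian, ← P.val_swap]
    exact P.differential_hamiltonian k f m
  rw [hdir, hkm, ← hval _ (hmem (π m)), P.differential_hamiltonian, ← P.val_swap]
  exact hloc _ (hmem (π m)) Y
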